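/- For a positive integer $r$ let $\delta_r=(r-1,r-2,\dots,1)$ be the staircase partition. A reverse plane partition $\pi$ of skew shape $\lambda/\mu$ is an assignment of nonnegative integers to the squares of $\lambda/\mu$ that is weakly increasing along each row (left to right) and down each column; $|\pi|$ is the sum of its entries. For a permutation $\tau=\tau_1\cdots\tau_r$ of $[r]$ let $\mathrm{maj}(\tau)=\sum_{1\le i\le r-1,\ \tau_i>\tau_{i+1}} i$. For $m\ge 1$ let $\mathrm{Ralt}_{2m+1}$ be the set of reverse alternating permutations of $[2m+1]$, i.e. those with $\sigma_1<\sigma_2>\sigma_3<\cdots>\sigma_{2m+1}$, let $\kappa=1\,3\,2\,5\,4\cdots(2m+1)(2m)$, and let $\sigma^{-1}\kappa$ denote the permutation obtained from the word of $\sigma^{-1}$ by interchanging the values $2i$ and $2i+1$ for all $1\le i\le m$. Put $$E^*_{2m+1}(q)=\sum_{\sigma\in\mathrm{Ralt}_{2m+1}}q^{\mathrm{maj}(\sigma^{-1}\kappa)},\qquad \widetilde E^*_{2m+1}(q)=\frac{E^*_{2m+1}(q)}{(1-q)(1-q^2)\cdots(1-q^{2m+1})}.$$ Then for all positive integers $n$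 and $k$, as formal power series in $q$, $$q^{N}\sum_{\pi}q^{|\pi|}=\det\Bigl[\widetilde E^*_{2(n+i+j)-3}(q)\Bigr]_{i,j=1}^{k},\qquad N=\frac{k(k-1)(6n+8k-1)}{6},$$ where $\pi$ runs over all reverse plane partitions of shape $\delta_{n+2k}/\delta_n$. -/

import Mathlib

open Finset

/-- The staircase partition `δ_n = (n-1, n-2, …, 1)` as a Young diagram; with `0`-based
coordinates its row `i` consists of the squares `(i, j)` with `j < n - 1 - i`. -/
def staircase (n : ℕ) : YoungDiagram where
  cells := (range n ×ˢ range n).filter fun c => c.1 + c.2 + 1 < n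
  isLowerSet := by
    rintro ⟨a, b⟩ ⟨c, d⟩ ⟨h1, h2⟩ h
    simp only [coe_filter, mem_product, mem_range, Set.mem_ofPred_eq] at h h1 h2 ⊢
    omega

theorem mem_staircase {n i j : ℕ} : (i, j) ∈ staircase n ↔ i + j + 1 < n := by
  rw [← YoungDiagram.mem_cells]
  simp only [staircase, mem_filter, mem_product, mem_range]
  omega

/-- A reverse plane partition of skew shape `lam/mu`: an assignment of nonnegative integers to the
squares of `lam/mu`, weakly increasing along each row and down each column. -/
@[ext]
structure ReversePlanePartition (lam mu : YoungDiagram) where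
  /-- the entries -/
  entry : {c : ℕ × ℕ // c ∈ lam.cells \ mu.cells} → ℕ
  row_weak : ∀ c d : {c : ℕ × ℕ // c ∈ lam.cells \ mu.cells},
    c.1.1 = d.1.1 → c.1.2 ≤ d.1.2 → entry c ≤ entry d
  col_weak : ∀ c d : {c : ℕ × ℕ // c ∈ lam.cells \ mu.cells},
    c.1.2 = d.1.2 → c.1.1 ≤ d.1.1 → entry c ≤ entry d

namespace ReversePlanePartition

/-- The weight `|π|`, the sum of all entries. -/
def weight {lam mu : YoungDiagram} (p : ReversePlanePartition lam mu) : ℕ :=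
  ∑ c, p.entry c

/-- Only finitely many reverse plane partitions have a given weight, so that the cardinality in
`genFun` below is a genuine one. -/
theorem finite_weight_eq (lam mu : YoungDiagram) (m : ℕ) :
    Finite {p : ReversePlanePartition lam mu // p.weight = m} := by
  refine Finite.of_injective
    (β := {c : ℕ × ℕ // c ∈ lam.cells \ mu.cells} → Fin (m + 1))
    (fun p c => ⟨p.1.entry c, ?_⟩) ?_
  · have h : p.1.entry c ≤ p.1.weight :=
      single_le_sum (f := p.1.entry) (fun _ _ => Nat.zero_le _) (mem_univ c)
    have h2 := p.2
    omega
  · intro p r h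
    apply Subtype.ext
    apply ReversePlanePartition.ext
    funext c
    exact congrArg Fin.val (congrFun h c)

/-- The generating function `∑_π q^|π|` over the reverse plane partitions of shape `lam/mu`, a
formal power series in `q`: the coefficient of `q^m` is the number of those of weight `m`. -/
noncomputable def genFun (lam mu : YoungDiagram) : PowerSeries ℚ :=
  PowerSeries.mk fun m => (Nat.card {p : ReversePlanePartition lam mu // p.weight = m} : ℚ)

end ReversePlanePartition

/-- Reverse alternating permutations `σ_1 < σ_2 > σ_3 < ⋯`. Positions and values are `0`-based
here, so ascents are at the even and descents at the odd positions. -/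
def IsReverseAlternating {n : ℕ} (s : Equiv.Perm (Fin n)) : Prop :=
  ∀ i j : Fin n, j.1 = i.1 + 1 → (Even i.1 → s i < s j) ∧ (Odd i.1 → s j < s i)

open Classical in
/-- The descent set `{i | 1 ≤ i ≤ n - 1, σ_i > σ_{i+1}}`, with `1`-based `i`. -/
noncomputable def descents {n : ℕ} (s : Equiv.Perm (Fin n)) : Finset ℕ :=
  (Icc 1 (n - 1)).filter fun i =>
    ∃ a b : Fin n, a.1 + 1 = i ∧ b.1 = i ∧ s b < s a

/-- The major index, the sum of the descents. -/
noncomputable def majorIndex {n : ℕ} (s : Equiv.Perm (Fin n)) : ℕ :=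
  ∑ i ∈ descents s, i

/-- The value at `v` of `κ = 1 3 2 5 4 ⋯ (2m+1) (2m)`, in `0`-based form: it fixes `0` and
interchanges `2i - 1` and `2i` for `1 ≤ i ≤ m`. -/
def kappaFun (m : ℕ) (v : Fin (2 * m + 1)) : Fin (2 * m + 1) :=
  if h : v.1 % 2 = 1 then ⟨v.1 + 1, by omega⟩ else ⟨v.1 - 1, by omega⟩

theorem kappaFun_involutive (m : ℕ) : Function.Involutive (kappaFun m) := by
  rintro ⟨v, hv⟩
  apply Fin.ext
  by_cases h : v % 2 = 1
  · have h2 : ¬ (v + 1) % 2 = 1 := by omega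
    simp [kappaFun, h, h2]
  · by_cases h0 : v = 0
    · simp [kappaFun, h0]
    · have h2 : (v - 1) % 2 = 1 := by omega
      simp only [kappaFun, h, h2, dite_true, dite_false]
      omega

/-- The reverse alternating permutation `κ = 1 3 2 5 4 ⋯ (2m+1) (2m)`. -/
def kappa (m : ℕ) : Equiv.Perm (Fin (2 * m + 1)) :=
  (kappaFun_involutive m).toPerm

open Classical in
/-- `E*_{2m+1}(q)`, the sum of `q^maj(σ⁻¹κ)` over the reverse alternating permutations `σ`, where
`σ⁻¹κ` is the permutation obtained from the word of `σ⁻¹` by interchanging the *values* `2i` and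
`2i + 1`. In Mathlib's convention (the right factor acts first) this is `κ * σ⁻¹`. -/
noncomputable def eulerStar (m : ℕ) : PowerSeries ℚ :=
  ∑ s ∈ (univ : Finset (Equiv.Perm (Fin (2 * m + 1)))).filter IsReverseAlternating,
    (PowerSeries.X : PowerSeries ℚ) ^ majorIndex (kappa m * s⁻¹)

/-- `Ẽ*_{2m+1}(q) = E*_{2m+1}(q) / ((1 - q) ⋯ (1 - q^{2m+1}))` as a formal power series; the
denominator has constant coefficient `1`. -/
noncomputable def eulerStarTilde (m : ℕ) : PowerSeries ℚ :=
  eulerStar m * (∏ i ∈ Icc 1 (2 * m + 1), (1 - (PowerSeries.X : PowerSeries ℚ) ^ i))⁻¹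

/-- The exponent `N = k(k-1)(6n+8k-1)/6`. -/
def shiftExponent (n k : ℕ) : ℕ := k * (k - 1) * (6 * n + 8 * k - 1) / 6

/-- The division in `shiftExponent` is exact (and its subtractions do not truncate). -/
theorem shiftExponent_spec (n k : ℕ) (hk : 1 ≤ k) :
    (shiftExponent n k : ℚ) = (k : ℚ) * (k - 1) * (6 * n + 8 * k - 1) / 6 := by
  have key : ∀ l : ℕ, 6 ∣ (l + 1) * l * (2 * l + 1) := by
    intro l
    induction l with
    | zero => simp
    | succ l ih =>
      have : (l + 1 + 1) * (l + 1) * (2 * (l + 1) + 1)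
          = (l + 1) * l * (2 * l + 1) + 6 * ((l + 1) * (l + 1)) := by ring
      rw [this]
      exact dvd_add ih (dvd_mul_right _ _)
  obtain ⟨l, rfl⟩ : ∃ l, k = l + 1 := ⟨k - 1, by omega⟩
  obtain ⟨c, hc⟩ := key l
  have h : (l + 1) * (l + 1 - 1) * (6 * n + 8 * (l + 1) - 1)
      = 6 * (c + (l + 1) * l * (n + l + 1)) := by
    have h1 : 6 * n + 8 * (l + 1) - 1 = 6 * (n + l + 1) + (2 * l + 1) := by omega
    rw [h1, Nat.add_sub_cancel, mul_add, hc]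
    ring
  have hs : shiftExponent n (l + 1) = c + (l + 1) * l * (n + l + 1) := by
    unfold shiftExponent
    rw [h]
    exact Nat.mul_div_cancel_left _ (by norm_num)
  have hc' : ((l : ℚ) + 1) * l * (2 * l + 1) = 6 * c := by exact_mod_cast hc
  rw [hs]
  push_cast
  linear_combination (-1 / 6 : ℚ) * hc'

/-! Both sides count families of disjoint zigzag paths. By the theory of `P`-partitions, `Ẽ*_{2m+1}`
is the generating function of the sequences `a_0 ≥ a_1 ≤ a_2 ≥ ⋯` of length `2m+1`
(`eulerStarTilde_eq_weightGF`): the positions are sorted by decreasing entry, ties being broken by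
`κ`, and the sorted sequence has to drop strictly exactly at the descents of `κσ⁻¹`.

The shape `δ_{n+2k}/δ_n` is cut into `k` strips of two consecutive antidiagonals each; strip `l = 0,
…, k-1` is a zigzag of `2n+4l+1` squares. Adding `l` to the entries of strip `l` makes the
inequalities between neighbouring strips strict and raises the weight by `∑ l(2n+4l+1) = N`. Reverse
plane partitions thus become families of `k` disjoint zigzag paths (`pathFamilyEquiv`).

The determinant counts these families, as in the Lindström–Gessel–Viennot lemma, but by a sweep over
the diagonals ("times") in place of a sign-reversing involution. Given the heights at time `t`,
subtracting neighbouring rows turns one-sided conditions on the next heights into intervals between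
neighbouring paths (`det_stepMatrix`). Expanding by multilinearity (`det_sum_rows`) then gives the
determinants at time `t+1`, summed over the allowed steps. A bound `M` on the heights keeps the sums
finite and does not affect coefficients below `q^M`. -/

/-! ### Generating functions of weighted types -/

/-- The generating function of a type `A` with respect to a weight: the coefficient of `q^m` is
the number of elements of weight `m`. -/
noncomputable def weightGF {A : Type*} (wt : A → ℕ) : PowerSeries ℚ :=
  PowerSeries.mk fun m => (Nat.card {a : A // wt a = m} : ℚ)

theorem weightGF_congr {A B : Type*} {wA : A → ℕ} {wB : B → ℕ} (e : A ≃ B)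
    (h : ∀ a, wB (e a) = wA a) : weightGF wA = weightGF wB := by
  ext m
  simp only [weightGF, PowerSeries.coeff_mk]
  congr 1
  exact Nat.card_congr (e.subtypeEquiv fun a => by rw [h])

theorem weightGF_add_const {A : Type*} (wt : A → ℕ) (c : ℕ) :
    weightGF (fun a => wt a + c) = PowerSeries.X ^ c * weightGF wt := by
  ext m
  rw [PowerSeries.coeff_X_pow_mul']
  simp only [weightGF, PowerSeries.coeff_mk]
  split_ifs with h
  · congr 1
    exact Nat.card_congr (Equiv.subtypeEquivRight fun a => by omega)
  · have : IsEmpty {a : A // wt a + c = m} := ⟨fun a => by have := a.2; omega⟩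
    simp

/-- Finiteness matters because `Nat.card` is zero on infinite types. -/
theorem weightGF_sigma {ι : Type*} [Fintype ι] {B : ι → Type*} (wt : ∀ i, B i → ℕ)
    (hf : ∀ i m, Finite {b : B i // wt i b = m}) :
    weightGF (fun x : Σ i, B i => wt x.1 x.2) = ∑ i, weightGF (wt i) := by
  ext m
  rw [map_sum]
  simp only [weightGF, PowerSeries.coeff_mk]
  have := fun i => hf i m
  rw [← Nat.cast_sum, ← Nat.card_sigma]
  congr 1
  exact Nat.card_congr
    { toFun := fun x => ⟨x.1.1, x.1.2, x.2⟩
      invFun := fun x => ⟨⟨x.1, x.2.1⟩, x.2.2⟩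
      left_inv := fun _ => rfl
      right_inv := fun _ => rfl }

theorem weightGF_prod {A B : Type*} (wA : A → ℕ) (wB : B → ℕ)
    (hA : ∀ m, Finite {a : A // wA a = m}) (hB : ∀ m, Finite {b : B // wB b = m}) :
    weightGF (fun x : A × B => wA x.1 + wB x.2) = weightGF wA * weightGF wB := by
  ext m
  rw [PowerSeries.coeff_mul]
  simp only [weightGF, PowerSeries.coeff_mk, ← Nat.cast_mul, ← Nat.card_prod]
  rw [← Nat.cast_sum, ← sum_coe_sort (antidiagonal m)
    (fun x => Nat.card ({a : A // wA a = x.1} × {b : B // wB b = x.2})), ← Nat.card_sigma]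
  congr 1
  exact Nat.card_congr
    { toFun := fun x => ⟨⟨(wA x.1.1, wB x.1.2), by simpa using x.2⟩, ⟨x.1.1, rfl⟩, ⟨x.1.2, rfl⟩⟩
      invFun := fun x => ⟨(x.2.1.1, x.2.2.1), by
        rw [x.2.1.2, x.2.2.2]; exact mem_antidiagonal.1 x.1.2⟩
      left_inv := fun _ => rfl
      right_inv := by
        rintro ⟨⟨⟨i, j⟩, hij⟩, ⟨a, ha⟩, ⟨b, hb⟩⟩
        obtain rfl : wA a = i := ha
        obtain rfl : wB b = j := hb
        rfl }

theorem finite_weight_linear (p m : ℕ) :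
    Finite {c : Fin p → ℕ // ∑ i, (i.1 + 1) * c i = m} := by
  refine Finite.of_injective (β := Fin p → Fin (m + 1)) (fun c i => ⟨c.1 i, ?_⟩) ?_
  · have h : (i.1 + 1) * c.1 i ≤ ∑ i, (i.1 + 1) * c.1 i :=
      single_le_sum (f := fun i : Fin p => (i.1 + 1) * c.1 i) (fun _ _ => Nat.zero_le _)
        (mem_univ i)
    rw [c.2] at h
    nlinarith
  · intro c d h
    ext i
    exact congrArg Fin.val (congrFun h i)

theorem weightGF_mul_left (c : ℕ) :
    weightGF (fun a : ℕ => (c + 1) * a) = (1 - (PowerSeries.X : PowerSeries ℚ) ^ (c + 1))⁻¹ := by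
  have hcoeff : ∀ m, PowerSeries.coeff m (weightGF fun a : ℕ => (c + 1) * a) =
      if c + 1 ∣ m then 1 else 0 := by
    intro m
    simp only [weightGF, PowerSeries.coeff_mk]
    split_ifs with h
    · obtain ⟨b, rfl⟩ := h
      have : Unique {a : ℕ // (c + 1) * a = (c + 1) * b} :=
        { default := ⟨b, rfl⟩
          uniq := fun a => Subtype.ext (Nat.eq_of_mul_eq_mul_left (Nat.succ_pos c) a.2) }
      simp
    · have : IsEmpty {a : ℕ // (c + 1) * a = m} := ⟨fun a => h ⟨a.1, a.2.symm⟩⟩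
      simp
  rw [PowerSeries.eq_inv_iff_mul_eq_one (by simp)]
  ext m
  rw [mul_sub, mul_one, map_sub, PowerSeries.coeff_mul_X_pow', hcoeff, PowerSeries.coeff_one]
  rcases Nat.eq_zero_or_pos m with rfl | hm
  · simp
  · rcases le_or_gt (c + 1) m with h | h
    · have : c + 1 ∣ m - (c + 1) ↔ c + 1 ∣ m := by
        obtain ⟨r, rfl⟩ := Nat.exists_eq_add_of_le h
        simp
      simp [hcoeff, h, this, hm.ne']
    · have : ¬ c + 1 ∣ m := fun h' => absurd (Nat.le_of_dvd hm h') (by omega)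
      simp [this, hm.ne', Nat.not_le.2 h]

/-- A product of geometric series: `c i` is the multiplicity of the part `i + 1` in a partition with
parts at most `p`. -/
theorem weightGF_linear (p : ℕ) :
    weightGF (fun c : Fin p → ℕ => ∑ i, (i.1 + 1) * c i) =
      (∏ i ∈ Icc 1 p, (1 - (PowerSeries.X : PowerSeries ℚ) ^ i))⁻¹ := by
  induction p with
  | zero =>
    rw [PowerSeries.eq_inv_iff_mul_eq_one (by simp)]
    ext m
    simp only [weightGF, univ_eq_empty, sum_empty, Icc_eq_empty_of_lt Nat.zero_lt_one, prod_empty,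
      mul_one, PowerSeries.coeff_mk, PowerSeries.coeff_one]
    split_ifs with h
    · subst h
      simp
    · simp [Ne.symm h]
  | succ p ih =>
    rw [prod_Icc_succ_top (by omega), PowerSeries.mul_inv_rev, ← ih, ← weightGF_mul_left,
      ← weightGF_prod _ _ _ (finite_weight_linear p)]
    · refine weightGF_congr (Fin.snocEquiv fun _ => ℕ).symm fun c => ?_
      rw [Fin.sum_univ_castSucc, add_comm]
      rfl
    · intro m
      refine Finite.of_injective (β := Fin (m + 1)) (fun a => ⟨a.1, ?_⟩) ?_
      · have := a.2
        nlinarith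
      · intro a b h
        exact Subtype.ext (congrArg Fin.val h)

/-! ### Descending sequences with prescribed strict descents -/

/-- Weakly decreasing sequences with a strict descent from place `i` to place `i + 1` (counted from
`1`) whenever `i ∈ D`. -/
def IsDescending {n : ℕ} (D : Finset ℕ) (b : Fin (n + 1) → ℕ) : Prop :=
  ∀ i : Fin n, b i.succ + (if i.1 + 1 ∈ D then 1 else 0) ≤ b i.castSucc

/-- The sequence of partial sums from the right of `c` plus the indicator of `D`. -/
def tailSums {p : ℕ} (D : Finset ℕ) (c : Fin p → ℕ) (i : ℕ) : ℕ :=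
  ∑ j ∈ Ico i p, if h : j < p then c ⟨j, h⟩ + (if j + 1 ∈ D then 1 else 0) else 0

theorem tailSums_self {p : ℕ} (D : Finset ℕ) (c : Fin p → ℕ) : tailSums D c p = 0 := by
  simp [tailSums]

theorem tailSums_eq_add {p : ℕ} (D : Finset ℕ) (c : Fin p → ℕ) (i : Fin p) :
    tailSums D c i.1 =
      c i + (if i.1 + 1 ∈ D then 1 else 0) + tailSums D c (i.1 + 1) := by
  unfold tailSums
  rw [sum_eq_sum_Ico_succ_bot i.2]
  simp

/-- The increment at place `j`, counted from `0`, occurs in the first `j + 1` tail sums; the forced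
drops therefore contribute the sum of `D`, which is the major index when `D` is a descent set. -/
theorem sum_tailSums {p : ℕ} (D : Finset ℕ) (hD : D ⊆ Icc 1 p) (c : Fin p → ℕ) :
    ∑ i : Fin p, tailSums D c i.1 = ∑ i, (i.1 + 1) * c i + ∑ i ∈ D, i := by
  have h1 : ∑ i : Fin p, tailSums D c i.1 =
      ∑ j : Fin p, (j.1 + 1) * (c j + if j.1 + 1 ∈ D then 1 else 0) := by
    rw [Fin.sum_univ_eq_sum_range (fun i => tailSums D c i)]
    unfold tailSums
    rw [sum_comm' (t' := range p) (s' := fun j => range (j + 1))]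
    · rw [← Fin.sum_univ_eq_sum_range]
      simp
    · intro x y
      simp only [mem_range, mem_Ico]
      omega
  have h2 : ∑ j : Fin p, (j.1 + 1) * (if j.1 + 1 ∈ D then 1 else 0) = ∑ i ∈ D, i := by
    rw [Fin.sum_univ_eq_sum_range (fun j => (j + 1) * (if j + 1 ∈ D then 1 else 0)),
      range_eq_Ico, sum_Ico_add' (fun j => j * (if j ∈ D then 1 else 0))]
    simp only [mul_ite, mul_one, mul_zero]
    rw [← sum_filter]
    congr 1
    ext i
    simp only [mem_filter, mem_Ico, and_iff_right_iff_imp]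
    intro h
    have := mem_Icc.1 (hD h)
    omega
  rw [h1]
  simp only [mul_add, sum_add_distrib]
  rw [h2]

/-- Descending sequences are parametrized by their successive differences. -/
noncomputable def descendingEquiv {n : ℕ} (D : Finset ℕ) (hD : D ⊆ Icc 1 n) :
    (Fin (n + 1) → ℕ) ≃ {b : Fin (n + 1) → ℕ // IsDescending D b} :=
  Equiv.ofBijective
    (fun c => ⟨fun i => tailSums D c i.1, fun i => by
      have := tailSums_eq_add D c i.castSucc
      simp only [Fin.val_castSucc] at this
      simp only [Fin.val_succ, Fin.val_castSucc]
      omega⟩) <| by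
    constructor
    · intro c d h
      have h0 : ∀ i : ℕ, i ≤ n + 1 → tailSums D c i = tailSums D d i := by
        intro i hi
        rcases hi.lt_or_eq with hi | rfl
        · exact congrFun (congrArg Subtype.val h) ⟨i, hi⟩
        · rw [tailSums_self, tailSums_self]
      ext i
      have h1 := h0 i.1 i.2.le
      rw [tailSums_eq_add, tailSums_eq_add, h0 (i.1 + 1) i.2] at h1
      omega
    · rintro ⟨b, hb⟩
      -- Extension by `0` makes the last difference the last term itself; by `hD` no drop is forced
      -- there.
      let b' : ℕ → ℕ := fun i => if h : i < n + 1 then b ⟨i, h⟩ else 0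
      refine ⟨fun i => b' i.1 - b' (i.1 + 1) - (if i.1 + 1 ∈ D then 1 else 0), ?_⟩
      apply Subtype.ext
      funext i
      have key : ∀ r i : ℕ, i + r = n + 1 → tailSums D (fun i : Fin (n + 1) =>
          b' i.1 - b' (i.1 + 1) - (if i.1 + 1 ∈ D then 1 else 0)) i = b' i := by
        intro r
        induction r with
        | zero =>
          intro i hi
          obtain rfl : i = n + 1 := hi
          rw [tailSums_self]
          simp [b']
        | succ r ih =>
          intro i hi
          have h1 := tailSums_eq_add D (fun i : Fin (n + 1) =>
            b' i.1 - b' (i.1 + 1) - (if i.1 + 1 ∈ D then 1 else 0)) ⟨i, by omega⟩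
          simp only at h1
          rw [h1, ih (i + 1) (by omega)]
          have h2 : b' (i + 1) + (if i + 1 ∈ D then 1 else 0) ≤ b' i := by
            rcases Nat.lt_or_ge i n with h | h
            · have := hb ⟨i, h⟩
              simpa [b', h, h.le] using this
            · have : i + 1 ∉ D := fun h' => by have := mem_Icc.1 (hD h'); omega
              have h3 : ¬ i < n := by omega
              simp [b', this, h3]
          omega
      have := key (n + 1 - i.1) i.1 (by omega)
      exact this.trans (dif_pos i.2)

theorem finite_weight_sum (p m : ℕ) (P : (Fin p → ℕ) → Prop) :
    Finite {b : {b : Fin p → ℕ // P b} // ∑ i, b.1 i = m} := by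
  refine Finite.of_injective (β := Fin p → Fin (m + 1)) (fun c i => ⟨c.1.1 i, ?_⟩) ?_
  · have h := single_le_sum (f := c.1.1) (fun _ _ => Nat.zero_le _) (mem_univ i)
    rw [c.2] at h
    omega
  · intro c d h
    apply Subtype.ext
    apply Subtype.ext
    funext i
    exact congrArg Fin.val (congrFun h i)

theorem weightGF_descending {n : ℕ} (D : Finset ℕ) (hD : D ⊆ Icc 1 n) :
    weightGF (fun b : {b : Fin (n + 1) → ℕ // IsDescending D b} => ∑ i, b.1 i) =
      (PowerSeries.X : PowerSeries ℚ) ^ (∑ i ∈ D, i) *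
        (∏ i ∈ Icc 1 (n + 1), (1 - (PowerSeries.X : PowerSeries ℚ) ^ i))⁻¹ := by
  rw [← weightGF_linear, ← weightGF_add_const]
  refine (weightGF_congr (descendingEquiv D hD) fun c => ?_).symm
  exact sum_tailSums D (hD.trans (Icc_subset_Icc le_rfl n.le_succ)) c

theorem succ_mem_descents {n : ℕ} (w : Equiv.Perm (Fin (n + 1))) (i : Fin n) :
    i.1 + 1 ∈ descents w ↔ w i.succ < w i.castSucc := by
  simp only [descents, mem_filter, mem_Icc]
  constructor
  · rintro ⟨-, a, b, ha, hb, h⟩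
    obtain rfl : a = i.castSucc := Fin.ext (by simpa using ha)
    obtain rfl : b = i.succ := Fin.ext (by simpa using hb)
    exact h
  · intro h
    exact ⟨⟨by omega, by have := i.2; omega⟩, i.castSucc, i.succ, rfl, rfl, h⟩

theorem descents_subset {n : ℕ} (w : Equiv.Perm (Fin (n + 1))) : descents w ⊆ Icc 1 n :=
  filter_subset _ _

/-! ### Sorting zigzag sequences: `P`-partitions -/

/-- The key by which positions are sorted: first by decreasing entry, then by increasing label. -/
def sortKey {p : ℕ} (κ : Equiv.Perm (Fin p)) (a : Fin p → ℕ) (v : Fin p) : ℕᵒᵈ ×ₗ Fin p :=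
  toLex (OrderDual.toDual (a v), κ v)

theorem sortKey_lt_iff {p : ℕ} (κ : Equiv.Perm (Fin p)) (a : Fin p → ℕ) (v w : Fin p) :
    sortKey κ a v < sortKey κ a w ↔ a w < a v ∨ a v = a w ∧ κ v < κ w := by
  simp [sortKey, Prod.Lex.toLex_lt_toLex]

theorem sortKey_injective {p : ℕ} (κ : Equiv.Perm (Fin p)) (a : Fin p → ℕ) :
    Function.Injective (sortKey κ a) := by
  intro v w h
  exact κ.injective (congrArg (fun x => (ofLex x).2) h)

/-- At consecutive places the key increases if the entry drops, or if it stays equal and the label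
increases. A label descent therefore demands a strict drop and a label ascent only a weak one. -/
theorem isDescending_descents_iff {n : ℕ} (κ u : Equiv.Perm (Fin (n + 1))) (a : Fin (n + 1) → ℕ) :
    IsDescending (descents (κ * u)) (a ∘ u) ↔ StrictMono (sortKey κ a ∘ u) := by
  rw [Fin.strictMono_iff_lt_succ]
  refine forall_congr' fun i => ?_
  simp only [succ_mem_descents, Function.comp, sortKey_lt_iff, Equiv.Perm.mul_apply]
  have hne : κ (u i.succ) ≠ κ (u i.castSucc) := fun h => by
    have := congrArg Fin.val (u.injective (κ.injective h))
    simp at this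
  rcases lt_or_gt_of_ne hne with h | h
  · simp [h, h.not_gt]
  · simp [h, h.not_gt]
    omega

/-- Sequences with `a_0 ≥ a_1 ≤ a_2 ≥ a_3 ≤ ⋯`. -/
def IsZigzag {p : ℕ} (a : Fin p → ℕ) : Prop :=
  ∀ i j : Fin p, j.1 = i.1 + 1 → (Even i.1 → a j ≤ a i) ∧ (Odd i.1 → a i ≤ a j)

theorem kappa_lt_of_even {m : ℕ} {i j : Fin (2 * m + 1)} (h : j.1 = i.1 + 1) (hi : Even i.1) :
    kappa m i < kappa m j := by
  have h1 : i.1 % 2 = 0 := Nat.even_iff.1 hi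
  have h2 : j.1 % 2 = 1 := by omega
  have h3 : ¬ i.1 % 2 = 1 := by omega
  rw [Fin.lt_def]
  simp only [kappa, Function.Involutive.coe_toPerm, kappaFun, h2, h3, dite_true, dite_false]
  omega

theorem kappa_lt_of_odd {m : ℕ} {i j : Fin (2 * m + 1)} (h : j.1 = i.1 + 1) (hi : Odd i.1) :
    kappa m j < kappa m i := by
  have h1 : i.1 % 2 = 1 := Nat.odd_iff.1 hi
  have h2 : ¬ j.1 % 2 = 1 := by omega
  rw [Fin.lt_def]
  simp only [kappa, Function.Involutive.coe_toPerm, kappaFun, h1, h2, dite_true, dite_false]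
  omega

theorem lt_iff_sortKey_lt {p : ℕ} {κ σ : Equiv.Perm (Fin p)} {a : Fin p → ℕ}
    (h : StrictMono (sortKey κ a ∘ ⇑σ⁻¹)) (i j : Fin p) :
    σ i < σ j ↔ sortKey κ a i < sortKey κ a j := by
  rw [← h.lt_iff_lt]
  simp

/-- Since `κ` is itself reverse alternating, ties between neighbouring positions are broken in the
direction required of `σ`; this is why the inequalities on `a` are weak. -/
theorem isReverseAlternating_iff_isZigzag {m : ℕ} {σ : Equiv.Perm (Fin (2 * m + 1))}
    {a : Fin (2 * m + 1) → ℕ} (h : StrictMono (sortKey (kappa m) a ∘ ⇑σ⁻¹)) :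
    IsReverseAlternating σ ↔ IsZigzag a := by
  refine forall₂_congr fun i j => forall_congr' fun hij => ?_
  rw [lt_iff_sortKey_lt h, lt_iff_sortKey_lt h, sortKey_lt_iff, sortKey_lt_iff]
  refine and_congr (forall_congr' fun he => ?_) (forall_congr' fun ho => ?_)
  · have := kappa_lt_of_even hij he
    simp only [this, and_true]
    omega
  · have := kappa_lt_of_odd hij ho
    simp only [this, and_true]
    omega

/-- Every zigzag sequence is, for exactly one reverse alternating `σ`, of the form `b ∘ σ` with `b`
descending strictly at the descents of `κ σ⁻¹`. -/
noncomputable def zigzagEquiv (m : ℕ) :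
    (Σ σ : {σ : Equiv.Perm (Fin (2 * m + 1)) // IsReverseAlternating σ},
      {b : Fin (2 * m + 1) → ℕ // IsDescending (descents (kappa m * σ.1⁻¹)) b}) ≃
    {a : Fin (2 * m + 1) → ℕ // IsZigzag a} :=
  Equiv.ofBijective
    (fun x => ⟨x.2.1 ∘ x.1.1, (isReverseAlternating_iff_isZigzag <| by
      rw [← isDescending_descents_iff]
      have h : (x.2.1 ∘ ⇑x.1.1) ∘ ⇑x.1.1⁻¹ = x.2.1 := by ext; simp
      rw [h]
      exact x.2.2).1 x.1.2⟩) <| by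
    constructor
    · rintro ⟨⟨σ, hσ⟩, ⟨b, hb⟩⟩ ⟨⟨τ, hτ⟩, ⟨c, hc⟩⟩ h
      have h1 : b ∘ σ = c ∘ τ := congrArg Subtype.val h
      have hb1 : b = (b ∘ σ) ∘ ⇑σ⁻¹ := by ext; simp
      have hc1 : c = (b ∘ σ) ∘ ⇑τ⁻¹ := by rw [h1]; ext; simp
      have hb2 := hb
      have hc2 := hc
      rw [hb1, isDescending_descents_iff] at hb2
      rw [hc1, isDescending_descents_iff] at hc2
      -- Strictly increasing maps on a finite chain are determined by their range, and both maps
      -- range over all keys.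
      have h2 : sortKey (kappa m) (b ∘ σ) ∘ ⇑σ⁻¹ = sortKey (kappa m) (b ∘ σ) ∘ ⇑τ⁻¹ := by
        rw [← hb2.range_inj hc2, Set.range_comp, Set.range_comp, (σ⁻¹).surjective.range_eq,
          (τ⁻¹).surjective.range_eq]
      obtain rfl : σ = τ :=
        inv_injective (DFunLike.coe_injective ((sortKey_injective _ _).comp_left h2))
      obtain rfl : b = c := by rw [hc1, ← hb1]
      rfl
    · rintro ⟨a, ha⟩
      let u := Tuple.sort (sortKey (kappa m) a)
      have hu : StrictMono (sortKey (kappa m) a ∘ ⇑(u⁻¹)⁻¹) := by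
        rw [inv_inv]
        exact (Tuple.monotone_sort _).strictMono_of_injective
          ((sortKey_injective _ _).comp u.injective)
      refine ⟨⟨⟨u⁻¹, (isReverseAlternating_iff_isZigzag hu).2 ha⟩, ⟨a ∘ u, ?_⟩⟩, ?_⟩
      · have := (isDescending_descents_iff _ _ _).2 hu
        rwa [inv_inv] at this ⊢
      · apply Subtype.ext
        ext i
        simp

theorem eulerStarTilde_eq_weightGF (m : ℕ) :
    eulerStarTilde m =
      weightGF (fun a : {a : Fin (2 * m + 1) → ℕ // IsZigzag a} => ∑ i, a.1 i) := by
  classical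
  rw [← weightGF_congr (wA := fun x => ∑ i, x.2.1 i) (zigzagEquiv m)]
  · rw [weightGF_sigma (fun σ (b : {b : Fin (2 * m + 1) → ℕ //
      IsDescending (descents (kappa m * (σ : {σ // IsReverseAlternating σ}).1⁻¹)) b}) =>
        ∑ i, b.1 i) fun σ r => finite_weight_sum _ r _]
    simp only [weightGF_descending _ (descents_subset _)]
    rw [← sum_mul, eulerStarTilde, eulerStar]
    congr 1
    rw [sum_filter, ← sum_filter, sum_subtype (p := IsReverseAlternating) _ (by simp)]
    rfl
  · rintro ⟨σ, b⟩
    exact Equiv.sum_comp σ.1 b.1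

/-! ### Transfer recursions and determinant identities -/

section Transfer

variable {S R : Type*} [Fintype S] [CommSemiring R]

/-- Iterated transfer: a quantity that satisfies a linear recursion along `L` steps is a sum over
all sequences of `L` states. -/
theorem transfer_eq_sum (L : ℕ) (f : ℕ → S → S → R) (W : ℕ → S → R) (P : ℕ → S → Prop)
    (hL : ∀ v, W L v = 1)
    (hW : ∀ t < L, ∀ v, P t v → W t v = ∑ v', f t v v' * W (t + 1) v')
    (hP : ∀ t v v', P t v → f t v v' = 0 ∨ P (t + 1) v') (v : S) (hv : P 0 v) :
    W 0 v = ∑ x : Fin L → S,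
      ∏ i : Fin L, f i.1 ((Fin.cons v x : Fin (L + 1) → S) i.castSucc) (x i) := by
  induction L generalizing f W P v with
  | zero => simp [hL]
  | succ L ih =>
    rw [hW 0 (Nat.succ_pos L) v hv, ← (Fin.consEquiv fun _ => S).sum_comp, Fintype.sum_prod_type]
    refine sum_congr rfl fun v' _ => ?_
    simp only [Fin.prod_univ_succ, Fin.consEquiv_apply, Fin.cons_zero, Fin.castSucc_zero,
      Fin.cons_succ, Fin.castSucc_succ, Fin.val_zero, Fin.val_succ]
    rw [← mul_sum]
    rcases hP 0 v v' hv with h | h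
    · simp [h]
    · rw [← ih (fun t => f (t + 1)) (fun t => W (t + 1)) (fun t => P (t + 1)) hL
        (fun t ht => hW (t + 1) (by omega)) (fun t => hP (t + 1)) v' h]

/-- The weight of a sequence of steps that are allowed or forbidden. -/
theorem prod_ite_pow {L : ℕ} (X : R) (p : Fin L → Prop) [DecidablePred p] [Decidable (∀ i, p i)]
    (w : Fin L → ℕ) :
    ∏ i, (if p i then X ^ w i else 0) = if ∀ i, p i then X ^ ∑ i, w i else 0 := by
  split_ifs with h
  · rw [← prod_pow_eq_pow_sum]
    exact prod_congr rfl fun i _ => if_pos (h i)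
  · obtain ⟨i, hi⟩ := not_forall.1 h
    exact prod_eq_zero (mem_univ i) (if_neg hi)

end Transfer

section Determinants

variable {R : Type*} [CommRing R]

theorem det_sum_rows {k M : ℕ} (w : Fin k → Fin M → R) (c : Fin k → Fin k → Fin M → R) :
    Matrix.det (Matrix.of fun l j => ∑ y, w l y * c l j y) =
      ∑ v : Fin k → Fin M, (∏ l, w l (v l)) * Matrix.det (Matrix.of fun l j => c l j (v l)) := by
  have h := (Matrix.detRowAlternating (n := Fin k) (R := R)).toMultilinearMap.map_sum
    (fun l y => w l y • fun j => c l j y)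
  simp only [MultilinearMap.map_smul_univ] at h
  refine Eq.trans ?_ (h.trans (sum_congr rfl fun v _ => rfl))
  change Matrix.det _ = Matrix.det _
  congr 1
  ext l j
  simp [Finset.sum_apply]

/-- The factor `1 - C` is unitriangular: all row operations are done at once, each using the
original rows. -/
theorem det_sub_mul_of_upper {k : ℕ} (A C : Matrix (Fin k) (Fin k) R)
    (hC : ∀ l l', l' ≤ l → C l l' = 0) : Matrix.det (A - C * A) = Matrix.det A := by
  have h : A - C * A = (1 - C) * A := by rw [sub_mul, one_mul]
  have h1 : Matrix.det (1 - C) = 1 := by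
    rw [Matrix.det_of_isUpperTriangular]
    · exact prod_eq_one fun i _ => by simp [hC i i le_rfl]
    · intro i j hij
      have hij : j < i := hij
      simp [hC i j hij.le, hij.ne']
  rw [h, Matrix.det_mul, h1, one_mul]

theorem det_sub_mul_of_lower {k : ℕ} (A C : Matrix (Fin k) (Fin k) R)
    (hC : ∀ l l', l ≤ l' → C l l' = 0) : Matrix.det (A - C * A) = Matrix.det A := by
  have h : A - C * A = (1 - C) * A := by rw [sub_mul, one_mul]
  have h1 : Matrix.det (1 - C) = 1 := by
    rw [Matrix.det_of_isLowerTriangular]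
    · exact prod_eq_one fun i _ => by simp [hC i i le_rfl]
    · intro i j hij
      have hij : i < j := hij
      simp [hC i j hij.le, hij.ne]
  rw [h, Matrix.det_mul, h1, one_mul]

end Determinants

/-! ### Generating functions of single zigzag paths -/

/-- The generating function of zigzag paths with `d` further steps that start at height `x` and
whose heights stay below `M`; the path goes down first if and only if `d` is even. -/
noncomputable def zigzagGF (M : ℕ) : ℕ → ℕ → PowerSeries ℚ
  | 0, _ => 1
  | d + 1, x => ∑ y : Fin M,
      (if if Even d then x ≤ y.1 else y.1 ≤ x then PowerSeries.X ^ y.1 else 0) * zigzagGF M d y.1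

/-- Of the next heights above `a`, those above `b` cancel. With `a` and `b` the heights of
neighbouring paths, only upward steps that stay below the neighbour survive. -/
theorem zigzagGF_even_sub {M d a b : ℕ} (hd : Even d) (hab : a ≤ b) :
    zigzagGF M (d + 1) a - zigzagGF M (d + 1) b = ∑ y : Fin M,
      (if a ≤ y.1 ∧ y.1 < b then PowerSeries.X ^ y.1 else 0) * zigzagGF M d y.1 := by
  simp only [zigzagGF, hd, if_true]
  rw [← sum_sub_distrib]
  refine sum_congr rfl fun y _ => ?_
  rw [← sub_mul]
  congr 1
  by_cases h1 : a ≤ y.1 <;> by_cases h2 : b ≤ y.1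
  · simp [h1, h2]
  · simp [h1, h2]
  · omega
  · simp [h1, h2]

theorem zigzagGF_odd_sub {M d a b : ℕ} (hd : ¬ Even d) (hab : a ≤ b) :
    zigzagGF M (d + 1) b - zigzagGF M (d + 1) a = ∑ y : Fin M,
      (if y.1 ≤ b ∧ a < y.1 then PowerSeries.X ^ y.1 else 0) * zigzagGF M d y.1 := by
  simp only [zigzagGF, hd, if_false]
  rw [← sum_sub_distrib]
  refine sum_congr rfl fun y _ => ?_
  rw [← sub_mul]
  congr 1
  by_cases h1 : y.1 ≤ a <;> by_cases h2 : y.1 ≤ b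
  · simp [h1, h2]
  · omega
  · simp [h1, h2, not_le.1 h1]
  · simp [h1, h2]

/-- Zigzag paths of odd length from height `0` are zigzag sequences. -/
theorem zigzagGF_eq_sum {M : ℕ} (hM : 0 < M) (p : ℕ)
    [DecidablePred fun a : Fin (2 * p + 1) → Fin M => IsZigzag fun i => (a i).1] :
    zigzagGF M (2 * p + 1) 0 = ∑ a : Fin (2 * p + 1) → Fin M,
      if IsZigzag (fun i => (a i).1) then PowerSeries.X ^ (∑ i, (a i).1) else 0 := by
  have h := transfer_eq_sum (S := Fin M) (2 * p + 1)
    (fun t v y => if (if Even t then v ≤ y else y ≤ v) then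
      (PowerSeries.X : PowerSeries ℚ) ^ y.1 else 0)
    (fun t v => zigzagGF M (2 * p + 1 - t) v.1) (fun _ _ => True)
    (fun v => by simp [zigzagGF]) ?_ (fun _ _ _ _ => Or.inr trivial) ⟨0, hM⟩ trivial
  · refine h.trans (sum_congr rfl fun a _ => ?_)
    rw [prod_ite_pow]
    congr 1
    rw [eq_iff_iff]
    constructor
    · intro H i j hij
      have H1 := H j
      have hj : j = Fin.succ (n := 2 * p) ⟨i.1, by omega⟩ := Fin.ext hij
      have hc : (Fin.cons ⟨0, hM⟩ a : Fin (2 * p + 1 + 1) → Fin M) j.castSucc = a i := by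
        rw [hj, Fin.castSucc_succ, Fin.cons_succ]
        rfl
      rw [hc, hij] at H1
      constructor
      · intro hi
        rwa [if_neg (by simpa [Nat.even_add_one] using hi)] at H1
      · intro hi
        rwa [if_pos hi.add_one] at H1
    · intro H i
      induction i using Fin.cases with
      | zero => simp [Fin.le_def]
      | succ i =>
        rw [Fin.castSucc_succ, Fin.cons_succ, Fin.val_succ]
        have H1 := H i.castSucc i.succ rfl
        rw [Fin.val_castSucc] at H1
        split_ifs with hi
        · exact H1.2 (by simpa [Nat.even_add_one] using hi)
        · exact H1.1 (by simpa [Nat.even_add_one] using hi)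
  · intro t ht v _
    obtain ⟨d, hd⟩ : ∃ d, 2 * p + 1 - t = d + 1 := ⟨2 * p - t, by omega⟩
    have hd' : 2 * p + 1 - (t + 1) = d := by omega
    have hp : Even d ↔ Even t := by
      rw [Nat.even_iff, Nat.even_iff]
      omega
    simp only [hd, hd', zigzagGF, hp]
    rfl

/-! ### Families of disjoint paths and the sweep through the determinant -/

/-- At time `t` the path on strip `l` has entered. -/
abbrev Entered (k t l : ℕ) : Prop := k ≤ l + (t + 1) / 2

/-- At time `t` the path on strip `l` has left. -/
abbrev Exited (n k t l : ℕ) : Prop := n + k + l ≤ t / 2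

/-- At time `t` the path on strip `l` is present. -/
abbrev Present (n k t l : ℕ) : Prop := Entered k t l ∧ ¬ Exited n k t l

/-- The admissible heights `y` on strip `l` at time `t + 1`, if `v` are the heights at time `t`:
steps go up at even times and down at odd times, and the vertical segments traversed on different
strips are disjoint. Strips without a path have height `0`. -/
def StepAllowed (n k t : ℕ) (v : Fin k → ℕ) (l : Fin k) (y : ℕ) : Prop :=
  if Present n k (t + 1) l.1 then
    if Even t then v l ≤ y ∧ ∀ l' : Fin k, l'.1 = l.1 + 1 → y < v l'
    else y ≤ v l ∧ ∀ l' : Fin k, l.1 = l'.1 + 1 → Entered k t l'.1 → v l' < y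
  else y = 0

/-- The generating function of the single paths from height `y` on strip `l` at time `t` to the end
of strip `j`; before the entrance of `l` these are the paths from the entrance. -/
noncomputable def pathEntry (n k M t l j y : ℕ) : PowerSeries ℚ :=
  if Entered k t l then
    if Exited n k t j ∨ Exited n k t l then if l = j then 1 else 0
    else zigzagGF M (2 * (n + k + j) - 1 - t) y
  else zigzagGF M (2 * (n + l + j) + 1) 0

/-- The matrix of `pathEntry`. -/
noncomputable def pathMatrix (n k M t : ℕ) (v : Fin k → ℕ) :
    Matrix (Fin k) (Fin k) (PowerSeries ℚ) :=
  Matrix.of fun l j => pathEntry n k M t l.1 j.1 (v l)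

/-- The states reached by the sweep. -/
structure IsState (n k t : ℕ) (v : Fin k → ℕ) : Prop where
  mono : Monotone v
  entered : ∀ l : Fin k, ¬ Present n k t l.1 → v l = 0

/-- Present strips form an upper set of indices, and the old height of one of two neighbouring paths
separates their new heights: `v' l < v (l+1) ≤ v' (l+1)` going up, `v' l ≤ v l < v' (l+1)` going
down. -/
theorem IsState.step {n k t : ℕ} {v v' : Fin k → ℕ} (hv : IsState n k t v)
    (h : ∀ l, StepAllowed n k t v l (v' l)) : IsState n k (t + 1) v' where
  entered l hl := by
    have := h l
    rwa [StepAllowed, if_neg hl] at this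
  mono := by
    cases k with
    | zero => exact fun i => i.elim0
    | succ k =>
    rw [Fin.monotone_iff_le_succ]
    intro i
    have h1 := h i.castSucc
    have h2 := h i.succ
    simp only [StepAllowed, Fin.val_castSucc, Fin.val_succ] at h1 h2
    by_cases p1 : Present n (k + 1) (t + 1) i.1
    · have p2 : Present n (k + 1) (t + 1) (i.1 + 1) := ⟨by omega, by omega⟩
      rw [if_pos p1] at h1
      rw [if_pos p2] at h2
      split_ifs at h1 h2 with he
      · exact (h1.2 i.succ rfl).le.trans h2.1
      · have h3 : Entered (k + 1) t i.1 := by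
          have := Nat.not_even_iff.1 he
          have := p1.1
          omega
        exact h1.1.trans (h2.2 i.castSucc rfl h3).le
    · rw [if_neg p1] at h1
      omega

section Rows

variable {n k M t : ℕ} {v : Fin k → ℕ}

open Classical in
/-- The matrix of the next step before it is expanded along its rows. -/
noncomputable def stepMatrix (n k M t : ℕ) (v : Fin k → ℕ) :
    Matrix (Fin k) (Fin k) (PowerSeries ℚ) :=
  Matrix.of fun l j => ∑ y : Fin M, (if StepAllowed n k t v l y.1 then PowerSeries.X ^ y.1 else 0) *
    pathEntry n k M (t + 1) l.1 j.1 y.1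

theorem stepMatrix_of_not_present (hM : 0 < M) {l : Fin k} (hl : ¬ Present n k (t + 1) l.1)
    (j : Fin k) : stepMatrix n k M t v l j = pathEntry n k M (t + 1) l.1 j.1 0 := by
  simp only [stepMatrix, Matrix.of_apply, StepAllowed, if_neg hl]
  rw [sum_eq_single (⟨0, hM⟩ : Fin M)]
  · simp
  · intro y _ hy
    have : y.1 ≠ 0 := fun h => hy (Fin.ext h)
    simp [this]
  · simp

theorem stepMatrix_of_present {l : Fin k} (hl : Present n k (t + 1) l.1) (j : Fin k) :
    stepMatrix n k M t v l j = if Exited n k (t + 1) j.1 then 0 else ∑ y : Fin M,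
      (if if Even t then v l ≤ y.1 ∧ ∀ l' : Fin k, l'.1 = l.1 + 1 → y.1 < v l'
        else y.1 ≤ v l ∧ ∀ l' : Fin k, l.1 = l'.1 + 1 → Entered k t l'.1 → v l' < y.1
        then PowerSeries.X ^ y.1 else 0) *
      zigzagGF M (2 * (n + k + j.1) - 1 - (t + 1)) y.1 := by
  classical
  simp only [stepMatrix, Matrix.of_apply, StepAllowed, if_pos hl, pathEntry, if_pos hl.1]
  by_cases hj : Exited n k (t + 1) j.1
  · have hlj : l.1 ≠ j.1 := fun h => hl.2 (h ▸ hj)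
    rw [if_pos hj]
    exact sum_eq_zero fun y _ => by rw [if_pos (Or.inl hj), if_neg hlj, mul_zero]
  · rw [if_neg hj]
    refine sum_congr rfl fun y _ => ?_
    rw [if_neg (not_or.2 ⟨hj, hl.2⟩)]

/-- Each row present after the step loses the row above it in height, so that `zigzagGF_even_sub`
confines the new height to `[v l, v (l+1))`. The topmost path has no upper constraint other than
`M`. -/
theorem det_stepMatrix_up (hM : 0 < M) (hv : IsState n k t v) (ht : Even t) :
    Matrix.det (stepMatrix n k M t v) = Matrix.det (pathMatrix n k M t v) := by
  let C : Matrix (Fin k) (Fin k) (PowerSeries ℚ) := Matrix.of fun l l' =>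
    if Present n k (t + 1) l.1 ∧ l'.1 = l.1 + 1 then 1 else 0
  have ht2 := Nat.even_iff.1 ht
  rw [← det_sub_mul_of_upper (pathMatrix n k M t v) C]
  · congr 1
    ext1 l j
    by_cases hl : Present n k (t + 1) l.1
    · have hC : (C * pathMatrix n k M t v) l j = if h : l.1 + 1 < k then
          pathMatrix n k M t v ⟨l.1 + 1, h⟩ j else 0 := by
        rw [Matrix.mul_apply]
        split_ifs with h
        · rw [sum_eq_single (⟨l.1 + 1, h⟩ : Fin k)]
          · simp [C, hl]
          · intro b _ hb
            have : b.1 ≠ l.1 + 1 := fun h => hb (Fin.ext h)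
            simp [C, this]
          · simp
        · refine sum_eq_zero fun b _ => ?_
          have : b.1 ≠ l.1 + 1 := by omega
          simp [C, this]
      rw [Matrix.sub_apply, hC, stepMatrix_of_present hl]
      obtain ⟨hl1, hl2⟩ := hl
      simp only [pathMatrix, Matrix.of_apply, pathEntry, ht, if_true]
      by_cases hj : Exited n k t j.1
      · have e1 : Exited n k (t + 1) j.1 := by omega
        have e2 : Entered k t l.1 := by omega
        have e3 : Entered k t (l.1 + 1) := by omega
        have e4 : l.1 ≠ j.1 := by omega
        have e5 : l.1 + 1 ≠ j.1 := by omega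
        simp only [e1, e2, e3, e4, e5, hj, true_or, if_true, if_false]
        split_ifs <;> simp
      · have e1 : ¬ Exited n k (t + 1) j.1 := by omega
        have e2 : ¬ Exited n k t l.1 := by omega
        have e3 : Entered k t (l.1 + 1) := by omega
        have e4 : ¬ Exited n k t (l.1 + 1) := by omega
        obtain ⟨d, hd⟩ : ∃ d, 2 * (n + k + j.1) - 1 - t = d + 1 :=
          ⟨2 * (n + k + j.1) - 1 - (t + 1), by omega⟩
        have hd' : 2 * (n + k + j.1) - 1 - (t + 1) = d := by omega
        have hdp : Even d := by
          rw [Nat.even_iff]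
          omega
        -- A strip that enters with this step has height `0` and `t = 2(k-l)-2`, so its entry before
        -- entrance agrees with the general formula.
        have hA : (if Entered k t l.1 then
            if Exited n k t j.1 ∨ Exited n k t l.1 then if l.1 = j.1 then 1 else 0
            else zigzagGF M (d + 1) (v l)
            else zigzagGF M (2 * (n + l.1 + j.1) + 1) 0) = zigzagGF M (d + 1) (v l) := by
          by_cases e : Entered k t l.1
          · rw [if_pos e, if_neg (not_or.2 ⟨hj, e2⟩)]
          · rw [if_neg e, hv.entered l fun h => e h.1]
            congr 1
            omega
        rw [hd, hA, hd', if_neg e1]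
        simp only [e3, e4, hj, or_self, if_true, if_false]
        split_ifs with h
        · rw [zigzagGF_even_sub hdp (hv.mono (Fin.le_def.2 (Nat.le_succ _)))]
          refine sum_congr rfl fun y _ => ?_
          congr 2
          rw [eq_iff_iff]
          refine and_congr_right fun _ => ⟨fun H => H _ rfl, fun H l' hl' => ?_⟩
          obtain rfl : l' = ⟨l.1 + 1, h⟩ := Fin.ext hl'
          exact H
        · rw [sub_zero, zigzagGF]
          refine sum_congr rfl fun y _ => ?_
          congr 2
          simp only [hdp, if_true, eq_iff_iff, and_iff_left_iff_imp]
          intro _ l' hl'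
          omega
    · have hC : (C * pathMatrix n k M t v) l j = 0 := by
        rw [Matrix.mul_apply]
        exact sum_eq_zero fun b _ => by simp [C, hl]
      rw [Matrix.sub_apply, hC, sub_zero, stepMatrix_of_not_present hM hl, pathMatrix,
        Matrix.of_apply, pathEntry, pathEntry]
      by_cases e1 : Entered k (t + 1) l.1
      · have e2 : Exited n k (t + 1) l.1 := by
          by_contra h
          exact hl ⟨e1, h⟩
        have e3 : Exited n k t l.1 := by omega
        have e4 : Entered k t l.1 := by omega
        simp [e1, e2, e3, e4]
      · have e2 : ¬ Entered k t l.1 := by omega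
        rw [if_neg e1, if_neg e2]
  · intro l l' h
    have : ¬ (l'.1 = l.1 + 1) := fun h' => by have := Fin.le_def.1 h; omega
    simp [C, this]

open Classical in
/-- The row operations for a downward step. -/
noncomputable def downOperations (n k t : ℕ) : Matrix (Fin k) (Fin k) (PowerSeries ℚ) :=
  Matrix.of fun l l' =>
    if Present n k (t + 1) l.1 ∧ l.1 = l'.1 + 1 ∧ Entered k t l'.1 then 1 else 0

theorem downOperations_mul_of_entered (A : Matrix (Fin k) (Fin k) (PowerSeries ℚ)) {l l' : Fin k}
    (hl : Present n k (t + 1) l.1) (h : l.1 = l'.1 + 1) (he : Entered k t l'.1) (j : Fin k) :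
    (downOperations n k t * A) l j = A l' j := by
  rw [Matrix.mul_apply, sum_eq_single l']
  · simp [downOperations, hl, h.symm, he]
  · intro b _ hb
    have : l.1 ≠ b.1 + 1 := fun h' => hb (Fin.ext (by omega))
    simp [downOperations, this]
  · simp

theorem downOperations_mul_of_not (A : Matrix (Fin k) (Fin k) (PowerSeries ℚ)) {l : Fin k}
    (h : Present n k (t + 1) l.1 → ∀ l' : Fin k, l.1 = l'.1 + 1 → ¬ Entered k t l'.1)
    (j : Fin k) : (downOperations n k t * A) l j = 0 := by
  rw [Matrix.mul_apply]
  refine sum_eq_zero fun b _ => ?_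
  rw [downOperations, Matrix.of_apply, if_neg, zero_mul]
  rintro ⟨h1, h2, h3⟩
  exact h h1 b h2 h3

/-- The hypothesis `hl` leaves out the strip that is left in this very step: its row becomes a unit
vector, which subtraction of a neighbouring row does not produce. -/
theorem stepMatrix_down_row (hM : 0 < M) (hv : IsState n k t v) (ht : ¬ Even t) {l : Fin k}
    (hl : Exited n k (t + 1) l.1 → Exited n k t l.1) (j : Fin k) :
    stepMatrix n k M t v l j =
      (pathMatrix n k M t v - downOperations n k t * pathMatrix n k M t v) l j := by
  have ht2 := Nat.not_even_iff.1 ht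
  rw [Matrix.sub_apply]
  by_cases hp : Present n k (t + 1) l.1
  · rw [stepMatrix_of_present hp]
    have e1 : Entered k t l.1 := by
      have := hp.1
      omega
    have e2 : ¬ Exited n k t l.1 := by
      have := hp.2
      omega
    have hA : pathMatrix n k M t v l j = if Exited n k t j.1 then 0 else
        zigzagGF M (2 * (n + k + j.1) - 1 - t) (v l) := by
      rw [pathMatrix, Matrix.of_apply, pathEntry, if_pos e1]
      by_cases hj : Exited n k t j.1
      · have hlj : l.1 ≠ j.1 := fun h => e2 (h ▸ hj)
        simp [hj, hlj]
      · rw [if_neg (not_or.2 ⟨hj, e2⟩), if_neg hj]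
    have hA' : ∀ l' : Fin k, l.1 = l'.1 + 1 → Entered k t l'.1 → pathMatrix n k M t v l' j =
        if Exited n k t j.1 then 0 else zigzagGF M (2 * (n + k + j.1) - 1 - t) (v l') := by
      intro l' hl' he
      have e3 : ¬ Exited n k t l'.1 := by
        have := hp.2
        omega
      rw [pathMatrix, Matrix.of_apply, pathEntry, if_pos he]
      by_cases hj : Exited n k t j.1
      · have hlj : l'.1 ≠ j.1 := fun h => e3 (h ▸ hj)
        simp [hj, hlj]
      · rw [if_neg (not_or.2 ⟨hj, e3⟩), if_neg hj]
    rw [hA]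
    by_cases hj : Exited n k (t + 1) j.1
    · rw [if_pos hj]
      have hlt : j.1 < l.1 := by
        have := hp.2
        omega
      have he : Entered k t (l.1 - 1) := by omega
      rw [downOperations_mul_of_entered (l' := ⟨l.1 - 1, by omega⟩) _ hp (by simp only; omega) he,
        hA' ⟨l.1 - 1, by omega⟩ (by simp only; omega) he]
      by_cases hj' : Exited n k t j.1
      · simp [hj']
      -- Strip `j` ends at time `t`; in its column both rows carry the empty path, of weight `1`,
      -- and cancel.
      · have : 2 * (n + k + j.1) - 1 - t = 0 := by omega
        simp only [if_neg hj', this, zigzagGF, sub_self]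
    · have hj' : ¬ Exited n k t j.1 := by omega
      simp only [if_neg hj'] at hA' ⊢
      rw [if_neg hj]
      obtain ⟨d, hd⟩ : ∃ d, 2 * (n + k + j.1) - 1 - t = d + 1 :=
        ⟨2 * (n + k + j.1) - 1 - (t + 1), by omega⟩
      have hd' : 2 * (n + k + j.1) - 1 - (t + 1) = d := by omega
      have hdp : ¬ Even d := by
        rw [Nat.not_even_iff]
        omega
      rw [hd] at hA' ⊢
      rw [hd']
      simp only [ht, if_false]
      by_cases h : ∃ l' : Fin k, l.1 = l'.1 + 1 ∧ Entered k t l'.1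
      · obtain ⟨l', h1, h2⟩ := h
        rw [downOperations_mul_of_entered _ hp h1 h2, hA' l' h1 h2,
          zigzagGF_odd_sub hdp (hv.mono (Fin.le_def.2 (by omega)))]
        refine sum_congr rfl fun y _ => ?_
        congr 2
        rw [eq_iff_iff]
        refine and_congr_right fun _ => ⟨fun H => H _ h1 h2, fun H b hb _ => ?_⟩
        obtain rfl : b = l' := Fin.ext (by omega)
        exact H
      · push Not at h
        rw [downOperations_mul_of_not _ fun _ l' h1 => not_le.2 (h l' h1), sub_zero, zigzagGF]
        refine sum_congr rfl fun y _ => ?_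
        congr 2
        simp only [hdp, if_false, eq_iff_iff, and_iff_left_iff_imp]
        intro _ l' h1 h2
        exact absurd h2 (not_le.2 (h l' h1))
  · rw [downOperations_mul_of_not _ fun h => absurd h hp, sub_zero,
      stepMatrix_of_not_present hM hp, pathMatrix, Matrix.of_apply, pathEntry, pathEntry]
    by_cases e1 : Entered k (t + 1) l.1
    · have e2 : Exited n k (t + 1) l.1 := by
        by_contra h
        exact hp ⟨e1, h⟩
      have e3 := hl e2
      have e4 : Entered k t l.1 := by omega
      simp [e1, e2, e3, e4]
    · have e2 : ¬ Entered k t l.1 := by omega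
      rw [if_neg e1, if_neg e2]

/-- At most one strip is left in a step. The reduced matrix then has a unit vector as the column of
that strip, while `stepMatrix` has unit vectors as both its row and its column; the other entries of
the row do not affect the determinant. -/
theorem det_stepMatrix_down (hM : 0 < M) (hv : IsState n k t v) (ht : ¬ Even t) :
    Matrix.det (stepMatrix n k M t v) = Matrix.det (pathMatrix n k M t v) := by
  have ht2 := Nat.not_even_iff.1 ht
  rw [← det_sub_mul_of_lower (pathMatrix n k M t v) (downOperations n k t)]
  · by_cases h : ∃ l : Fin k, Exited n k (t + 1) l.1 ∧ ¬ Exited n k t l.1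
    · obtain ⟨l, h1, h2⟩ := h
      have hne : ∀ l' : Fin k, l' ≠ l → Exited n k (t + 1) l'.1 → Exited n k t l'.1 := by
        intro l' hl' h
        have : l'.1 ≠ l.1 := fun h => hl' (Fin.ext h)
        omega
      have hnp : ¬ Present n k (t + 1) l.1 := fun h => h.2 h1
      have he : ∀ l' : Fin k, Entered k t l'.1 := fun l' => by omega
      have he' : ∀ l' : Fin k, Entered k (t + 1) l'.1 := fun l' => by omega
      have hrow : ∀ j, stepMatrix n k M t v l j = if l = j then 1 else 0 := by
        intro j
        rw [stepMatrix_of_not_present hM hnp, pathEntry, if_pos (he' l), if_pos (Or.inr h1)]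
        simp only [Fin.ext_iff]
      have hcol : ∀ i, i ≠ l → stepMatrix n k M t v i l = 0 := by
        intro i hi
        by_cases hp : Present n k (t + 1) i.1
        · rw [stepMatrix_of_present hp, if_pos h1]
        · rw [stepMatrix_of_not_present hM hp, pathEntry, if_pos (he' i), if_pos (Or.inl h1),
            if_neg fun h => hi (Fin.ext h)]
      have hop : ∀ j, (downOperations n k t * pathMatrix n k M t v) l j = 0 :=
        downOperations_mul_of_not _ fun h => absurd h hnp
      have hdiag : pathMatrix n k M t v l l = 1 := by
        have h0 : 2 * (n + k + l.1) - 1 - t = 0 := by omega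
        rw [pathMatrix, Matrix.of_apply, pathEntry, if_pos (he l), if_neg (not_or.2 ⟨h2, h2⟩), h0,
          zigzagGF]
      -- Multiples of the unit column `l` clear the rest of row `l`; transposition turns these
      -- column operations into row operations.
      rw [← Matrix.det_transpose, ← Matrix.det_transpose (_ - _)]
      refine (Matrix.det_eq_of_forall_row_eq_smul_add_const
        (fun j => if l = j then 0 else pathMatrix n k M t v l j) l (by simp) fun j i => ?_).symm
      simp only [Matrix.transpose_apply]
      by_cases hi : i = l
      · subst hi
        rw [Matrix.sub_apply, hop, sub_zero, hrow, hrow]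
        by_cases hj : i = j
        · subst hj
          simp [hdiag]
        · simp [hj]
      · rw [hcol i hi, mul_zero, add_zero, stepMatrix_down_row hM hv ht (hne i hi)]
    · push Not at h
      congr 1
      ext1 l j
      exact stepMatrix_down_row hM hv ht (h l) j
  · intro l l' h
    have : ¬ (l.1 = l'.1 + 1) := fun h' => by have := Fin.le_def.1 h; omega
    simp [downOperations, this]

theorem det_stepMatrix (hM : 0 < M) (hv : IsState n k t v) :
    Matrix.det (stepMatrix n k M t v) = Matrix.det (pathMatrix n k M t v) := by
  by_cases ht : Even t
  · exact det_stepMatrix_up hM hv ht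
  · exact det_stepMatrix_down hM hv ht

end Rows

open Classical in
/-- The determinant of the generating functions of single paths is the generating function of the
families of disjoint paths. -/
theorem det_zigzagGF_eq_sum {n k M : ℕ} (hM : 0 < M) (hk : 0 < k) :
    Matrix.det (Matrix.of fun i j : Fin k => zigzagGF M (2 * (n + i.1 + j.1) + 1) 0) =
      ∑ x : Fin (2 * n + 4 * k - 2) → Fin k → Fin M,
        if ∀ i, ∀ l, StepAllowed n k i.1
          (fun l => ((Fin.cons (fun _ => ⟨0, hM⟩) x : Fin (2 * n + 4 * k - 2 + 1) → Fin k → Fin M)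
            i.castSucc l).1) l (x i l).1
        then (PowerSeries.X : PowerSeries ℚ) ^ (∑ i, ∑ l, (x i l).1) else 0 := by
  have h := transfer_eq_sum (S := Fin k → Fin M) (2 * n + 4 * k - 2)
    (fun t v v' => if ∀ l, StepAllowed n k t (fun l => (v l).1) l (v' l).1 then
      (PowerSeries.X : PowerSeries ℚ) ^ (∑ l, (v' l).1) else 0)
    (fun t v => Matrix.det (pathMatrix n k M t fun l => (v l).1))
    (fun t v => IsState n k t fun l => (v l).1) ?_ ?_ ?_ (fun _ => ⟨0, hM⟩)
    ⟨fun _ _ _ => le_rfl, fun _ _ => rfl⟩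
  · simp only [prod_ite_pow] at h
    rw [← h]
    congr 1
    ext1 i j
    rw [pathMatrix, Matrix.of_apply, Matrix.of_apply, pathEntry]
    -- At time `0` no strip has been entered, so the matrix is the one in the statement.
    by_cases he : Entered k 0 i.1
    · omega
    · rw [if_neg he]
  · intro v
    -- At the final time every strip has been left.
    have h1 : pathMatrix n k M (2 * n + 4 * k - 2) (fun l => (v l).1) = 1 := by
      ext1 l j
      have e1 : Entered k (2 * n + 4 * k - 2) l.1 := by omega
      have e2 : Exited n k (2 * n + 4 * k - 2) l.1 := by omega
      rw [pathMatrix, Matrix.of_apply, pathEntry, if_pos e1, if_pos (Or.inr e2), Matrix.one_apply]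
      simp only [Fin.ext_iff]
    rw [h1, Matrix.det_one]
  · intro t _ v hv
    -- Row `l` at time `t + 1` depends on the new heights only through that of strip `l`, so the
    -- rows expand independently.
    rw [← det_stepMatrix hM hv, stepMatrix, det_sum_rows]
    refine sum_congr rfl fun v' _ => ?_
    rw [prod_ite_pow]
    rfl
  · intro t v v' hv
    by_cases hs : ∀ l, StepAllowed n k t (fun l => (v l).1) l (v' l).1
    · exact Or.inr (hv.step hs)
    · exact Or.inl (if_neg hs)

/-! ### Strips and diagonals of the skew staircase -/

/-- The square on strip `l` that is met at time `t`. -/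
def cellAt (n k t l : ℕ) : ℕ × ℕ := (n + k + l - 1 - t / 2, l + (t + 1) / 2 - k)

/-- The time at which a square is met. -/
def timeOf (n k : ℕ) (c : ℕ × ℕ) : ℕ := n + 2 * k - 1 + c.2 - c.1

/-- The strip of a square. -/
def stripOf (n : ℕ) (c : ℕ × ℕ) : ℕ := (c.1 + c.2 + 1 - n) / 2

theorem mem_skewStaircase {n k : ℕ} {c : ℕ × ℕ} :
    c ∈ (staircase (n + 2 * k)).cells \ (staircase n).cells ↔
      n ≤ c.1 + c.2 + 1 ∧ c.1 + c.2 + 1 < n + 2 * k := by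
  obtain ⟨i, j⟩ := c
  rw [mem_sdiff, YoungDiagram.mem_cells, YoungDiagram.mem_cells, mem_staircase, mem_staircase]
  omega

theorem cellAt_mem {n k t l : ℕ} (hl : l < k) (h : Present n k t l) :
    cellAt n k t l ∈ (staircase (n + 2 * k)).cells \ (staircase n).cells := by
  rw [mem_skewStaircase]
  obtain ⟨h1, h2⟩ := h
  simp only [cellAt]
  omega

theorem stripOf_lt {n k : ℕ} {c : ℕ × ℕ}
    (hc : c ∈ (staircase (n + 2 * k)).cells \ (staircase n).cells) :
    stripOf n c < k := by
  rw [mem_skewStaircase] at hc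
  simp only [stripOf]
  omega

theorem timeOf_pos {n k : ℕ} {c : ℕ × ℕ}
    (hc : c ∈ (staircase (n + 2 * k)).cells \ (staircase n).cells) :
    0 < timeOf n k c := by
  rw [mem_skewStaircase] at hc
  simp only [timeOf]
  omega

theorem timeOf_le {n k : ℕ} {c : ℕ × ℕ}
    (hc : c ∈ (staircase (n + 2 * k)).cells \ (staircase n).cells) :
    timeOf n k c ≤ 2 * n + 4 * k - 2 := by
  rw [mem_skewStaircase] at hc
  simp only [timeOf]
  omega

theorem present_of_mem {n k : ℕ} {c : ℕ × ℕ}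
    (hc : c ∈ (staircase (n + 2 * k)).cells \ (staircase n).cells) :
    Present n k (timeOf n k c) (stripOf n c) := by
  rw [mem_skewStaircase] at hc
  simp only [timeOf, stripOf]
  constructor <;> omega

theorem cellAt_timeOf_stripOf {n k : ℕ} {c : ℕ × ℕ}
    (hc : c ∈ (staircase (n + 2 * k)).cells \ (staircase n).cells) :
    cellAt n k (timeOf n k c) (stripOf n c) = c := by
  rw [mem_skewStaircase] at hc
  ext <;> simp only [timeOf, stripOf, cellAt] <;> omega

theorem timeOf_cellAt {n k t l : ℕ} (hl : l < k) (h : Present n k t l) :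
    timeOf n k (cellAt n k t l) = t := by
  obtain ⟨h1, h2⟩ := h
  simp only [timeOf, cellAt]
  omega

theorem stripOf_cellAt {n k t l : ℕ} (h : Present n k t l) :
    stripOf n (cellAt n k t l) = l := by
  obtain ⟨h1, h2⟩ := h
  simp only [stripOf, cellAt]
  omega

theorem le_exit_of_present {n k t l : ℕ} (hl : l < k) (h : Present n k t l) :
    0 < t ∧ t < 2 * n + 4 * k - 2 := by
  obtain ⟨h1, h2⟩ := h
  omega

/-! ### Reverse plane partitions as families of paths -/

/-- A family of paths on the strips whose steps are allowed. -/
structure IsPathFamily (n k : ℕ) (h : ℕ → ℕ → ℕ) : Prop where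
  zero_of_not_present : ∀ t, ∀ l < k, ¬ Present n k t l → h t l = 0
  up : ∀ t, ∀ l < k, Even t → Present n k t l → Present n k (t + 1) l → h t l ≤ h (t + 1) l
  up_lt : ∀ t l, l + 1 < k → Even t → Present n k (t + 1) l → Present n k t (l + 1) →
    h (t + 1) l < h t (l + 1)
  down : ∀ t, ∀ l < k, ¬ Even t → Present n k t l → Present n k (t + 1) l → h (t + 1) l ≤ h t l
  down_lt : ∀ t l, l + 1 < k → ¬ Even t → Present n k t l → Present n k (t + 1) (l + 1) →
    h t l < h (t + 1) (l + 1)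

theorem IsPathFamily.stepAllowed {n k : ℕ} {h : ℕ → ℕ → ℕ} (H : IsPathFamily n k h) (t : ℕ)
    (l : Fin k) : StepAllowed n k t (fun l => h t l.1) l (h (t + 1) l.1) := by
  rw [StepAllowed]
  split_ifs with hp ht
  · have ht2 := Nat.even_iff.1 ht
    constructor
    · by_cases hp' : Present n k t l.1
      · exact H.up t l.1 l.2 ht hp' hp
      · simp [H.zero_of_not_present t l.1 l.2 hp']
    · intro l' hl'
      simp only [hl']
      refine H.up_lt t l.1 (by omega) ht hp ?_
      obtain ⟨h1, h2⟩ := hp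
      constructor <;> omega
  · have ht2 := Nat.not_even_iff.1 ht
    constructor
    · refine H.down t l.1 l.2 ht ?_ hp
      obtain ⟨h1, h2⟩ := hp
      constructor <;> omega
    · intro l' hl' he
      have hl2 := l.2
      rw [hl'] at hp hl2 ⊢
      refine H.down_lt t l'.1 hl2 ht ?_ hp
      obtain ⟨h1, h2⟩ := hp
      constructor <;> omega
  · exact H.zero_of_not_present _ _ l.2 hp

theorem isPathFamily_of_stepAllowed {n k : ℕ} {h : ℕ → ℕ → ℕ}
    (h0 : ∀ t, ∀ l < k, ¬ Present n k t l → h t l = 0)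
    (H : ∀ t < 2 * n + 4 * k - 2, ∀ l : Fin k,
      StepAllowed n k t (fun l => h t l.1) l (h (t + 1) l.1)) : IsPathFamily n k h where
  zero_of_not_present := h0
  up t l hl ht hp hp' := by
    have := H t (le_exit_of_present hl hp).2 ⟨l, hl⟩
    rw [StepAllowed, if_pos hp', if_pos ht] at this
    exact this.1
  up_lt t l hl ht hp hp' := by
    have := H t (le_exit_of_present hl hp').2 ⟨l, by omega⟩
    rw [StepAllowed, if_pos hp, if_pos ht] at this
    exact this.2 ⟨l + 1, hl⟩ rfl
  down t l hl ht hp hp' := by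
    have := H t (le_exit_of_present hl hp).2 ⟨l, hl⟩
    rw [StepAllowed, if_pos hp', if_neg ht] at this
    exact this.1
  down_lt t l hl ht hp hp' := by
    have := H t (le_exit_of_present (by omega) hp).2 ⟨l + 1, hl⟩
    rw [StepAllowed, if_pos hp', if_neg ht] at this
    exact this.2 ⟨l, by omega⟩ rfl hp.1

/-- Each strip is strictly above the previous one, so heights gain at least `1` per strip. This
makes the truncated subtraction in `entryOf` exact. -/
theorem IsPathFamily.strip_le {n k : ℕ} {h : ℕ → ℕ → ℕ} (H : IsPathFamily n k h) :
    ∀ l t : ℕ, l < k → Present n k t l → l ≤ h t l := by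
  intro l
  induction l with
  | zero => exact fun _ _ _ => Nat.zero_le _
  | succ l ih =>
    have even_case : ∀ t, l + 1 < k → Present n k t (l + 1) → Even t → l + 1 ≤ h t (l + 1) := by
      intro t hl hp ht
      have ht2 := Nat.even_iff.1 ht
      by_cases hp' : Present n k (t + 1) l
      · exact (ih _ (by omega) hp').trans_lt (H.up_lt t l hl ht hp' hp)
      -- Strip `l` has just been left; its last square, at time `t - 1`, is compared instead.
      · obtain ⟨h1, h2⟩ := hp
        obtain ⟨s, rfl⟩ : ∃ s, t = s + 1 := ⟨t - 1, by omega⟩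
        have hs : ¬ Even s := by
          rw [Nat.not_even_iff]
          omega
        have hp2 : Present n k s l := by
          have : ¬ Entered k (s + 1 + 1) l ∨ Exited n k (s + 1 + 1) l := by
            by_contra h
            push Not at h
            exact hp' ⟨h.1, not_le.2 h.2⟩
          constructor <;> omega
        exact (ih _ (by omega) hp2).trans_lt (H.down_lt s l hl hs hp2 ⟨h1, h2⟩)
    intro t hl hp
    by_cases ht : Even t
    · exact even_case t hl hp ht
    · have ht2 := Nat.not_even_iff.1 ht
      by_cases hp' : Present n k (t + 1) (l + 1)
      · exact (even_case _ hl hp' (Nat.even_add_one.2 ht)).trans (H.down t _ hl ht hp hp')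
      -- At the last time of strip `l + 1` there is no later square, but the preceding upward step
      -- gives the bound.
      · have hp0 := hp
        obtain ⟨h1, h2⟩ := hp
        obtain ⟨s, rfl⟩ : ∃ s, t = s + 1 := ⟨t - 1, by omega⟩
        have hs : Even s := by
          rw [Nat.even_iff]
          omega
        have hp2 : Present n k s (l + 1) := by
          have : ¬ Entered k (s + 1 + 1) (l + 1) ∨ Exited n k (s + 1 + 1) (l + 1) := by
            by_contra h
            push Not at h
            exact hp' ⟨h.1, not_le.2 h.2⟩
          constructor <;> omega
        exact (even_case _ hl hp2 hs).trans (H.up s _ hl hs hp2 hp0)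

namespace ReversePlanePartition

variable {n k : ℕ}

/-- The heights of the paths that encode a reverse plane partition of skew staircase shape. -/
def height (p : ReversePlanePartition (staircase (n + 2 * k)) (staircase n)) (t l : ℕ) : ℕ :=
  if h : l < k ∧ Present n k t l then p.entry ⟨cellAt n k t l, cellAt_mem h.1 h.2⟩ + l else 0

theorem height_of_present (p : ReversePlanePartition (staircase (n + 2 * k)) (staircase n))
    {t l : ℕ} (hl : l < k) (h : Present n k t l) :
    p.height t l = p.entry ⟨cellAt n k t l, cellAt_mem hl h⟩ + l :=
  dif_pos ⟨hl, h⟩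

theorem height_of_mem (p : ReversePlanePartition (staircase (n + 2 * k)) (staircase n))
    (c : {c : ℕ × ℕ // c ∈ (staircase (n + 2 * k)).cells \ (staircase n).cells}) :
    p.height (timeOf n k c.1) (stripOf n c.1) = p.entry c + stripOf n c.1 := by
  rw [height_of_present _ (stripOf_lt c.2) (present_of_mem c.2)]
  congr 2
  exact Subtype.ext (cellAt_timeOf_stripOf c.2)

/-- Steps along a strip go right at even times and up at odd times. The square below (even time) or
to the right (odd time) across a strip boundary lies on the next strip, where the extra `1` makes
the inequality strict. -/
theorem isPathFamily_height (p : ReversePlanePartition (staircase (n + 2 * k)) (staircase n)) :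
    IsPathFamily n k p.height where
  zero_of_not_present t l _ h := dif_neg fun h' => h h'.2
  up t l hl ht hp hp' := by
    have ht2 := Nat.even_iff.1 ht
    rw [height_of_present p hl hp, height_of_present p hl hp']
    refine Nat.add_le_add_right (p.row_weak _ _ ?_ ?_) _ <;> simp only [cellAt] <;> omega
  up_lt t l hl ht hp hp' := by
    have ht2 := Nat.even_iff.1 ht
    rw [height_of_present p (by omega) hp, height_of_present p hl hp', ← add_assoc,
      Nat.lt_succ_iff]
    obtain ⟨h1, h2⟩ := hp
    refine Nat.add_le_add_right (p.col_weak _ _ ?_ ?_) _ <;> simp only [cellAt] <;> omega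
  down t l hl ht hp hp' := by
    have ht2 := Nat.not_even_iff.1 ht
    rw [height_of_present p hl hp, height_of_present p hl hp']
    refine Nat.add_le_add_right (p.col_weak _ _ ?_ ?_) _ <;> simp only [cellAt] <;> omega
  down_lt t l hl ht hp hp' := by
    have ht2 := Nat.not_even_iff.1 ht
    rw [height_of_present p (by omega) hp, height_of_present p hl hp', ← add_assoc,
      Nat.lt_succ_iff]
    obtain ⟨h1, h2⟩ := hp
    refine Nat.add_le_add_right (p.row_weak _ _ ?_ ?_) _ <;> simp only [cellAt] <;> omega

end ReversePlanePartition

section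

variable {n k : ℕ} {h : ℕ → ℕ → ℕ}

/-- The entries encoded by a family of paths. -/
def entryOf (n k : ℕ) (h : ℕ → ℕ → ℕ) (c : ℕ × ℕ) : ℕ :=
  h (timeOf n k c) (stripOf n c) - stripOf n c

theorem entryOf_le_right (H : IsPathFamily n k h) (i j : ℕ)
    (h1 : (i, j) ∈ (staircase (n + 2 * k)).cells \ (staircase n).cells)
    (h2 : (i, j + 1) ∈ (staircase (n + 2 * k)).cells \ (staircase n).cells) :
    entryOf n k h (i, j) ≤ entryOf n k h (i, j + 1) := by
  have p1 := present_of_mem h1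
  have p2 := present_of_mem h2
  have s2 := stripOf_lt h2
  rw [mem_skewStaircase] at h1 h2
  simp only at h1 h2
  have et : timeOf n k (i, j + 1) = timeOf n k (i, j) + 1 := by
    simp only [timeOf]
    omega
  simp only [entryOf]
  rw [et] at p2 ⊢
  by_cases ht : Even (timeOf n k (i, j))
  · have ht2 := Nat.even_iff.1 ht
    have es : stripOf n (i, j + 1) = stripOf n (i, j) := by
      simp only [stripOf, timeOf] at ht2 ⊢
      omega
    rw [es] at p2 s2 ⊢
    exact Nat.sub_le_sub_right (H.up _ _ s2 ht p1 p2) _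
  · have ht2 := Nat.not_even_iff.1 ht
    have es : stripOf n (i, j + 1) = stripOf n (i, j) + 1 := by
      simp only [stripOf, timeOf] at ht2 ⊢
      omega
    rw [es] at p2 s2 ⊢
    have := H.down_lt _ _ s2 ht p1 p2
    omega

theorem entryOf_le_below (H : IsPathFamily n k h) (i j : ℕ)
    (h1 : (i, j) ∈ (staircase (n + 2 * k)).cells \ (staircase n).cells)
    (h2 : (i + 1, j) ∈ (staircase (n + 2 * k)).cells \ (staircase n).cells) :
    entryOf n k h (i, j) ≤ entryOf n k h (i + 1, j) := by
  have p1 := present_of_mem h1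
  have p2 := present_of_mem h2
  have s2 := stripOf_lt h2
  rw [mem_skewStaircase] at h1 h2
  simp only at h1 h2
  have et : timeOf n k (i, j) = timeOf n k (i + 1, j) + 1 := by
    simp only [timeOf]
    omega
  simp only [entryOf]
  rw [et] at p1 ⊢
  by_cases ht : Even (timeOf n k (i + 1, j))
  · have ht2 := Nat.even_iff.1 ht
    have es : stripOf n (i + 1, j) = stripOf n (i, j) + 1 := by
      simp only [stripOf, timeOf] at ht2 ⊢
      omega
    rw [es] at p2 s2 ⊢
    have := H.up_lt _ _ s2 ht p1 p2
    omega
  · have ht2 := Nat.not_even_iff.1 ht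
    have es : stripOf n (i + 1, j) = stripOf n (i, j) := by
      simp only [stripOf, timeOf] at ht2 ⊢
      omega
    rw [es] at p2 s2 ⊢
    exact Nat.sub_le_sub_right (H.down _ _ s2 ht p2 p1) _

/-- The reverse plane partition encoded by a family of paths. -/
def ReversePlanePartition.ofPathFamily (H : IsPathFamily n k h) :
    ReversePlanePartition (staircase (n + 2 * k)) (staircase n) where
  entry c := entryOf n k h c.1
  row_weak := by
    have key : ∀ r i j : ℕ, (i, j) ∈ (staircase (n + 2 * k)).cells \ (staircase n).cells →
        (i, j + r) ∈ (staircase (n + 2 * k)).cells \ (staircase n).cells →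
        entryOf n k h (i, j) ≤ entryOf n k h (i, j + r) := by
      intro r
      induction r with
      | zero => exact fun _ _ _ _ => le_rfl
      | succ r ih =>
        intro i j h1 h2
        have h3 : (i, j + r) ∈ (staircase (n + 2 * k)).cells \ (staircase n).cells := by
          rw [mem_skewStaircase] at h1 h2 ⊢
          simp only at h1 h2 ⊢
          omega
        exact (ih i j h1 h3).trans (entryOf_le_right H i (j + r) h3 h2)
    rintro ⟨⟨i, j⟩, hc⟩ ⟨⟨i', j'⟩, hd⟩ h1 h2
    obtain rfl : i = i' := h1
    obtain ⟨r, rfl⟩ : ∃ r, j' = j + r := Nat.exists_eq_add_of_le h2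
    exact key r i j hc hd
  col_weak := by
    have key : ∀ r i j : ℕ, (i, j) ∈ (staircase (n + 2 * k)).cells \ (staircase n).cells →
        (i + r, j) ∈ (staircase (n + 2 * k)).cells \ (staircase n).cells →
        entryOf n k h (i, j) ≤ entryOf n k h (i + r, j) := by
      intro r
      induction r with
      | zero => exact fun _ _ _ _ => le_rfl
      | succ r ih =>
        intro i j h1 h2
        have h3 : (i + r, j) ∈ (staircase (n + 2 * k)).cells \ (staircase n).cells := by
          rw [mem_skewStaircase] at h1 h2 ⊢
          simp only at h1 h2 ⊢
          omega
        exact (ih i j h1 h3).trans (entryOf_le_below H (i + r) j h3 h2)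
    rintro ⟨⟨i, j⟩, hc⟩ ⟨⟨i', j'⟩, hd⟩ h1 h2
    obtain rfl : j = j' := h1
    obtain ⟨r, rfl⟩ : ∃ r, i' = i + r := Nat.exists_eq_add_of_le h2
    exact key r i j hc hd

theorem ReversePlanePartition.height_ofPathFamily (H : IsPathFamily n k h) {t l : ℕ} (hl : l < k) :
    (ReversePlanePartition.ofPathFamily H).height t l = h t l := by
  by_cases hp : Present n k t l
  · rw [height_of_present _ hl hp]
    simp only [ofPathFamily, entryOf]
    rw [timeOf_cellAt hl hp, stripOf_cellAt hp]
    exact Nat.sub_add_cancel (H.strip_le l t hl hp)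
  · rw [H.zero_of_not_present t l hl hp]
    exact dif_neg fun h' => hp h'.2

end

/-! ### The weight shift and the bijection -/

theorem sum_present_eq_sum_cells (n k : ℕ) (F : ℕ → ℕ → ℕ) :
    ∑ c : {c : ℕ × ℕ // c ∈ (staircase (n + 2 * k)).cells \ (staircase n).cells},
      F (timeOf n k c.1) (stripOf n c.1) =
    ∑ τ : Fin (2 * n + 4 * k - 2), ∑ l : Fin k,
      if Present n k (τ.1 + 1) l.1 then F (τ.1 + 1) l.1 else 0 := by
  rw [← Fintype.sum_prod_type' (fun (τ : Fin (2 * n + 4 * k - 2)) (l : Fin k) =>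
    if Present n k (τ.1 + 1) l.1 then F (τ.1 + 1) l.1 else 0)]
  have hlt : ∀ c : {c : ℕ × ℕ // c ∈ (staircase (n + 2 * k)).cells \ (staircase n).cells},
      timeOf n k c.1 - 1 < 2 * n + 4 * k - 2 := fun c => by
    have := timeOf_pos c.2
    have := timeOf_le c.2
    omega
  have hsucc : ∀ c : {c : ℕ × ℕ // c ∈ (staircase (n + 2 * k)).cells \ (staircase n).cells},
      timeOf n k c.1 - 1 + 1 = timeOf n k c.1 := fun c => by
    have := timeOf_pos c.2
    omega
  refine sum_of_injOn (fun c => (⟨timeOf n k c.1 - 1, hlt c⟩, ⟨stripOf n c.1, stripOf_lt c.2⟩))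
    ?_ (fun _ _ => mem_univ _) ?_ ?_
  · intro c _ d _ h
    have h1 : timeOf n k c.1 - 1 = timeOf n k d.1 - 1 := congrArg (fun x => x.1.1) h
    have h2 : stripOf n c.1 = stripOf n d.1 := congrArg (fun x => x.2.1) h
    have h3 : timeOf n k c.1 = timeOf n k d.1 := by rw [← hsucc c, ← hsucc d, h1]
    apply Subtype.ext
    rw [← cellAt_timeOf_stripOf c.2, ← cellAt_timeOf_stripOf d.2, h2, h3]
  · rintro ⟨τ, l⟩ _ h
    refine if_neg fun hp => h ⟨⟨_, cellAt_mem l.2 hp⟩, mem_univ _, ?_⟩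
    simp only [Prod.mk.injEq, Fin.ext_iff]
    rw [timeOf_cellAt l.2 hp, stripOf_cellAt hp]
    simp
  · intro c _
    simp only [hsucc, if_pos (present_of_mem c.2)]

theorem sum_stripOf (n k : ℕ) (hk : 1 ≤ k) :
    ∑ c : {c : ℕ × ℕ // c ∈ (staircase (n + 2 * k)).cells \ (staircase n).cells},
      stripOf n c.1 = shiftExponent n k := by
  rw [sum_present_eq_sum_cells n k fun _ l => l, sum_comm]
  have h1 : ∀ l : Fin k, ∑ τ : Fin (2 * n + 4 * k - 2),
      (if Present n k (τ.1 + 1) l.1 then l.1 else 0) = (2 * n + 4 * l.1 + 1) * l.1 := by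
    intro l
    rw [Fin.sum_univ_eq_sum_range (fun τ => if Present n k (τ + 1) l.1 then l.1 else 0),
      ← sum_filter, sum_const, smul_eq_mul]
    congr 1
    -- Strip `l` is present at the times `2(k-l)-1, …, 2(n+k+l)-1`, and `τ` is the time minus one.
    have : (range (2 * n + 4 * k - 2)).filter (fun τ => Present n k (τ + 1) l.1) =
        Ico (2 * (k - 1 - l.1)) (2 * (n + k + l.1) - 1) := by
      ext τ
      simp only [mem_filter, mem_range, mem_Ico]
      omega
    rw [this, Nat.card_Ico]
    omega
  simp only [h1]
  rw [Fin.sum_univ_eq_sum_range (fun l => (2 * n + 4 * l + 1) * l)]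
  have h2 : ∀ k : ℕ, ((∑ l ∈ range k, (2 * n + 4 * l + 1) * l : ℕ) : ℚ) =
      (k : ℚ) * (k - 1) * (6 * n + 8 * k - 1) / 6 := by
    intro k
    induction k with
    | zero => simp
    | succ k ih =>
      rw [sum_range_succ, Nat.cast_add, ih]
      push_cast
      ring
  exact_mod_cast (h2 k).trans (shiftExponent_spec n k hk).symm

theorem ReversePlanePartition.sum_height {n k : ℕ} (hk : 1 ≤ k)
    (p : ReversePlanePartition (staircase (n + 2 * k)) (staircase n)) :
    ∑ τ : Fin (2 * n + 4 * k - 2), ∑ l : Fin k, p.height (τ.1 + 1) l.1 =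
      p.weight + shiftExponent n k := by
  rw [weight, ← sum_stripOf n k hk, ← sum_add_distrib]
  simp only [← height_of_mem]
  rw [sum_present_eq_sum_cells n k fun t l => p.height t l]
  refine sum_congr rfl fun τ _ => sum_congr rfl fun l _ => ?_
  split_ifs with h
  · rfl
  · exact dif_neg fun h' => h h'.2

/-- The heights at all times of a sequence of states, starting with the zero state. -/
def heightsOf {L k M : ℕ} (x : Fin L → Fin k → Fin M) (t l : ℕ) : ℕ :=
  if h : 0 < t ∧ t ≤ L ∧ l < k then (x ⟨t - 1, by omega⟩ ⟨l, h.2.2⟩).1 else 0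

theorem heightsOf_succ {L k M : ℕ} (x : Fin L → Fin k → Fin M) (τ : Fin L) (l : Fin k) :
    heightsOf x (τ.1 + 1) l.1 = (x τ l).1 := by
  rw [heightsOf, dif_pos ⟨Nat.succ_pos _, τ.2, l.2⟩]
  rfl

theorem cons_castSucc_eq_heightsOf {L k M : ℕ} (hM : 0 < M) (x : Fin L → Fin k → Fin M)
    (i : Fin L) (l : Fin k) :
    ((Fin.cons (fun _ => ⟨0, hM⟩) x : Fin (L + 1) → Fin k → Fin M) i.castSucc l).1 =
      heightsOf x i.1 l.1 := by
  obtain ⟨i, hi⟩ := i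
  cases i with
  | zero => rfl
  | succ i =>
    rw [heightsOf, dif_pos ⟨Nat.succ_pos _, hi.le, l.2⟩]
    rfl

theorem isPathFamily_heightsOf_iff {n k M : ℕ}
    (x : Fin (2 * n + 4 * k - 2) → Fin k → Fin M) :
    (∀ i : Fin (2 * n + 4 * k - 2), ∀ l : Fin k,
      StepAllowed n k i.1 (fun l => heightsOf x i.1 l.1) l (x i l).1) ↔
    IsPathFamily n k (heightsOf x) := by
  constructor
  · intro H
    refine isPathFamily_of_stepAllowed ?_ fun t ht l => ?_
    · intro t l hl hp
      rw [heightsOf]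
      split_ifs with h
      · have := H ⟨t - 1, by omega⟩ ⟨l, hl⟩
        have ht : t - 1 + 1 = t := by omega
        simp only [StepAllowed, ht] at this
        rwa [if_neg hp] at this
      · rfl
    · have := heightsOf_succ x ⟨t, ht⟩ l
      simp only at this
      rw [this]
      exact H ⟨t, ht⟩ l
  · intro H i l
    rw [← heightsOf_succ]
    exact H.stepAllowed i.1 l

/-- Reverse plane partitions of a given weight correspond to families of paths. -/
noncomputable def pathFamilyEquiv (n k m : ℕ) (hk : 1 ≤ k) :
    {p : ReversePlanePartition (staircase (n + 2 * k)) (staircase n) //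
      p.weight + shiftExponent n k = m} ≃
    {x : Fin (2 * n + 4 * k - 2) → Fin k → Fin (m + 1) //
      IsPathFamily n k (heightsOf x) ∧ ∑ i, ∑ l, (x i l).1 = m} := by
  have hle : ∀ p : {p : ReversePlanePartition (staircase (n + 2 * k)) (staircase n) //
      p.weight + shiftExponent n k = m}, ∀ (τ : Fin (2 * n + 4 * k - 2)) (l : Fin k),
      p.1.height (τ.1 + 1) l.1 < m + 1 := by
    intro p τ l
    have hp := (p.1.sum_height hk).trans p.2
    refine Nat.lt_succ_of_le (le_of_le_of_eq ?_ hp)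
    exact (single_le_sum (f := fun l : Fin k => p.1.height (τ.1 + 1) l.1)
      (fun _ _ => Nat.zero_le _) (mem_univ l)).trans
      (single_le_sum (f := fun τ : Fin (2 * n + 4 * k - 2) =>
        ∑ l : Fin k, p.1.height (τ.1 + 1) l.1) (fun _ _ => Nat.zero_le _) (mem_univ τ))
  have heq : ∀ p, heightsOf (fun τ l => (⟨_, hle p τ l⟩ : Fin (m + 1))) = p.1.height := by
    intro p
    funext t l
    rw [heightsOf]
    split_ifs with h
    · simp only [Nat.sub_add_cancel h.1]
    · rw [ReversePlanePartition.height, dif_neg]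
      refine fun h' => h ?_
      have := le_exit_of_present h'.1 h'.2
      exact ⟨this.1, this.2.le, h'.1⟩
  refine Equiv.ofBijective (fun p => ⟨fun τ l => ⟨_, hle p τ l⟩, ?_, ?_⟩) ⟨?_, ?_⟩
  · rw [heq]
    exact p.1.isPathFamily_height
  · exact (p.1.sum_height hk).trans p.2
  · intro p q h
    have h1 : p.1.height = q.1.height := by
      rw [← heq p, ← heq q]
      exact congrArg (fun x => heightsOf x.1) h
    apply Subtype.ext
    apply ReversePlanePartition.ext
    funext c
    have h2 := p.1.height_of_mem c
    have h3 := q.1.height_of_mem c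
    rw [h1] at h2
    omega
  · rintro ⟨x, H, hx⟩
    have h1 : ∀ (τ : Fin (2 * n + 4 * k - 2)) (l : Fin k),
        (ReversePlanePartition.ofPathFamily H).height (τ.1 + 1) l.1 = (x τ l).1 := by
      intro τ l
      rw [ReversePlanePartition.height_ofPathFamily H l.2, heightsOf_succ]
    refine ⟨⟨ReversePlanePartition.ofPathFamily H, ?_⟩, ?_⟩
    · rw [← ReversePlanePartition.sum_height hk]
      simpa only [h1] using hx
    · apply Subtype.ext
      funext τ l
      exact Fin.ext (h1 τ l)

/-! ### Comparison of coefficients and conclusion -/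

theorem coeff_sum_ite_X_pow {ι : Type*} [Fintype ι] (P : ι → Prop) [DecidablePred P] (w : ι → ℕ)
    (m : ℕ) :
    PowerSeries.coeff m (∑ x, if P x then (PowerSeries.X : PowerSeries ℚ) ^ w x else 0) =
      Nat.card {x // P x ∧ w x = m} := by
  rw [map_sum, Nat.card_eq_fintype_card, Fintype.card_subtype, card_eq_sum_ones, sum_filter]
  push_cast
  refine sum_congr rfl fun x _ => ?_
  by_cases h : P x
  · simp [h, PowerSeries.coeff_X_pow, eq_comm]
  · simp [h]

/-- A sequence of total `m` has entries at most `m`, so the bound `M` excludes none of them. -/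
theorem coeff_zigzagGF {M m p : ℕ} (h : m < M) :
    PowerSeries.coeff m (zigzagGF M (2 * p + 1) 0) =
      PowerSeries.coeff m (eulerStarTilde p) := by
  classical
  rw [zigzagGF_eq_sum (by omega), coeff_sum_ite_X_pow, eulerStarTilde_eq_weightGF, weightGF,
    PowerSeries.coeff_mk]
  congr 1
  refine Nat.card_congr
    { toFun := fun a => ⟨⟨fun i => (a.1 i).1, a.2.1⟩, a.2.2⟩
      invFun := fun a => ⟨fun i => ⟨a.1.1 i, ?_⟩, a.1.2, a.2⟩
      left_inv := fun _ => rfl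
      right_inv := fun _ => rfl }
  have := single_le_sum (f := a.1.1) (fun _ _ => Nat.zero_le _) (mem_univ i)
  rw [a.2] at this
  omega

/-- The determinant commutes with reduction modulo `X^(m+1)`. -/
theorem coeff_det_congr {R : Type*} [CommRing R] {k m : ℕ}
    (A B : Matrix (Fin k) (Fin k) (PowerSeries R))
    (h : ∀ i j, ∀ r ≤ m, PowerSeries.coeff r (A i j) = PowerSeries.coeff r (B i j)) :
    PowerSeries.coeff m A.det = PowerSeries.coeff m B.det := by
  let I : Ideal (PowerSeries R) := Ideal.span {PowerSeries.X ^ (m + 1)}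
  have hAB : (Ideal.Quotient.mk I).mapMatrix A = (Ideal.Quotient.mk I).mapMatrix B := by
    ext1 i j
    refine Ideal.Quotient.eq.2 (Ideal.mem_span_singleton.2 (PowerSeries.X_pow_dvd_iff.2 ?_))
    intro r hr
    rw [map_sub, h i j r (by omega), sub_self]
  have h1 : Ideal.Quotient.mk I A.det = Ideal.Quotient.mk I B.det := by
    rw [RingHom.map_det, RingHom.map_det, hAB]
  have h2 := PowerSeries.X_pow_dvd_iff.1 (Ideal.mem_span_singleton.1 (Ideal.Quotient.eq.1 h1)) m
    (Nat.lt_succ_self m)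
  rwa [map_sub, sub_eq_zero] at h2

/-- With `0`-based `i, j : Fin k`, the `(i+1, j+1)` entry `Ẽ*_{2(n+(i+1)+(j+1))-3}` is `Ẽ*_{2m+1}`
for `m = n + i + j`. -/
theorem mainTheorem1 (n k : ℕ) (hn : 1 ≤ n) (hk : 1 ≤ k) :
    (PowerSeries.X : PowerSeries ℚ) ^ shiftExponent n k *
        ReversePlanePartition.genFun (staircase (n + 2 * k)) (staircase n) =
      Matrix.det (Matrix.of fun i j : Fin k => eulerStarTilde (n + i.1 + j.1)) := by
  classical
  have hgf : (PowerSeries.X : PowerSeries ℚ) ^ shiftExponent n k *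
      ReversePlanePartition.genFun (staircase (n + 2 * k)) (staircase n) =
      weightGF fun p : ReversePlanePartition (staircase (n + 2 * k)) (staircase n) =>
        p.weight + shiftExponent n k :=
    (weightGF_add_const ReversePlanePartition.weight _).symm
  rw [hgf]
  ext m
  -- The bound `m + 1` suffices for the coefficient of `q^m` and is the one used in
  -- `pathFamilyEquiv`.
  rw [← coeff_det_congr (Matrix.of fun i j : Fin k => zigzagGF (m + 1) (2 * (n + i.1 + j.1) + 1) 0)
    (Matrix.of fun i j : Fin k => eulerStarTilde (n + i.1 + j.1)) fun i j r hr => coeff_zigzagGF (Nat.lt_succ_of_le hr),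
    det_zigzagGF_eq_sum (Nat.succ_pos m) hk, coeff_sum_ite_X_pow, weightGF, PowerSeries.coeff_mk]
  congr 1
  refine Nat.card_congr ((pathFamilyEquiv n k m hk).trans (Equiv.subtypeEquivRight fun x => ?_))
  rw [← isPathFamily_heightsOf_iff]
  simp only [cons_castSucc_eq_heightsOf]
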